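/- Let $\mu,\nu$ be partitions (possibly empty), with weight $|\mu|$, length $l(\mu)$, conjugate $\mu'$, and $\kappa_\mu=|\mu|+\sum_i(\mu_i^2-2i\mu_i)$. For a power series $E(t)=\sum_{n\ge 0}e_nt^n$ put $$s_{\alpha/\beta}(E(t))=\det\big(e_{\alpha'_i-\beta'_j-i+j}\big)_{1\le i,j\le m},\qquad m=\max(l(\alpha'),l(\beta')),$$ with $e_n=0$ for $n<0$, and $s_\alpha=s_{\alpha/\emptyset}$. Let $K$ be a field, $q^{1/2}\in K$ a nonzero element whose square $q$ is not a root of unity (for example $K=\mathbb{Q}(q^{1/2})$, or $K=\mathbb C$), and $[m]=q^{m/2}-q^{-m/2}$. Let $s_{\alpha/\beta}(1,q,q^2,\dots)\in K$ be the value of the rational function obtained for $$E(t)=\prod_{i\ge1}(1+q^{i-1}t)=\sum_{n\ge0}\frac{q^{n(n-1)/2}\,t^n}{\prod_{i=1}^n(1-q^i)},$$ where the last expression serves as the definition over $K$, and let $$\mathcal E_\mu(q,t)=\prod_{j=1}^{l(\mu)}\frac{1+q^{\mu_j-j}t}{1+q^{-j}t}\cdot\Big(1+\sum_{n\ge1}\frac{t^n}{\prod_{i=1}^n(q^i-1)}\Big),$$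 $$\mathcal W_\mu=q^{\kappa_\mu/4}\prod_{1\le i<j\le l(\mu)}\frac{[\mu_i-\mu_j+j-i]}{[j-i]}\prod_{i=1}^{l(\mu)}\prod_{v=1}^{\mu_i}\frac1{[v-i+l(\mu)]},\qquad \mathcal W_{\mu,\nu}=q^{|\nu|/2}\,\mathcal W_\mu\, s_\nu(\mathcal E_\mu(q,t)).$$ Then $s_{\mu/\rho}(1,q,\dots)\ne0$ for only finitely many partitions $\rho$, $s_\mu(1,q,\dots)\neq0$, and $$s_\nu(\mathcal E_\mu(q,t))=(-1)^{|\nu|}q^{\kappa_\nu/2}\sum_\rho q^{-|\rho|}\,\frac{s_{\mu/\rho}(1,q,q^2,\dots)}{s_\mu(1,q,q^2,\dots)}\,s_{\nu/\rho}(1,q,q^2,\dots),$$ $$\mathcal W_{\mu,\nu}=(-1)^{|\mu|+|\nu|}q^{(\kappa_\mu+\kappa_\nu+|\mu|+|\nu|)/2}\sum_\rho q^{-|\rho|}s_{\mu/\rho}(1,q,\dots)\,s_{\nu/\rho}(1,q,\dots),$$ where $\rho$ runs over all partitions; in particular $\mathcal W_{\mu,\nu}=\mathcal W_{\nu,\mu}$.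 Moreover, these specializations are the values of the (skew) Schur functions in infinitely many variables wherever the latter converge. For $q\in\mathbb C$ with $|q|<1$ and $\beta\subseteq\alpha$, the sum over all semistandard tableaux $T$ of shape $\alpha/\beta$ with entries in $\{1,2,\dots\}$ of the monomials $\prod_{c\in\alpha/\beta}x_{T(c)}$ at $x_k=q^{k-1}$ converges absolutely to $s_{\alpha/\beta}(1,q,q^2,\dots)$. For $q\in\mathbb C$ with $|q|>1$, the sum over all semistandard tableaux $T$ of shape $\nu$ of $\prod_{c\in\nu}x_{T(c)}$ at $x_k=q^{\mu_k-k}$ (with $\mu_k=0$ for $k>l(\mu)$) converges absolutely to $s_\nu(\mathcal E_\mu(q,t))$; that is, $s_\nu(\mathcal E_\mu(q,t))=s_\nu(q^{\mu_1-1},q^{\mu_2-2},\dots)$. -/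

import Mathlib

open PowerSeries

universe u

noncomputable section

namespace ZhouW

/-! Partitions are Young diagrams: the parts `μ₁ ≥ μ₂ ≥ …` of `μ` are `μ.rowLen 0, μ.rowLen 1, …`,
the parts of the conjugate partition `μ'` are `μ.colLen 0, μ.colLen 1, …`, the length `l(μ)` is
`μ.colLen 0`, the weight `|μ|` is `μ.card`, and `ρ ⊆ μ` is `ρ ≤ μ`. -/

/-- `κ_μ = |μ| + ∑ᵢ (μᵢ² - 2 i μᵢ)`. -/
def kappa (μ : YoungDiagram) : ℤ :=
  (μ.card : ℤ) +
    ∑ i ∈ Finset.range (μ.colLen 0), ((μ.rowLen i : ℤ) ^ 2 - 2 * ((i : ℤ) + 1) * (μ.rowLen i : ℤ))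

/-- The number of cells is the sum of the parts. -/
theorem card_eq_sum_rowLen (μ : YoungDiagram) :
    μ.card = ∑ i ∈ Finset.range (μ.colLen 0), μ.rowLen i := by
  have h : ∀ c ∈ μ.cells, c.1 ∈ Finset.range (μ.colLen 0) := by
    rintro ⟨i, j⟩ hc
    rw [Finset.mem_range, ← YoungDiagram.mem_iff_lt_colLen]
    exact μ.up_left_mem le_rfl (Nat.zero_le j) ((YoungDiagram.mem_cells _).1 hc)
  rw [YoungDiagram.card, Finset.card_eq_sum_card_fiberwise h]
  refine Finset.sum_congr rfl fun i _ => ?_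
  rw [YoungDiagram.rowLen_eq_card]
  rfl

/-- `κ_μ` is always even, so the integer division in `kappa μ / 2` below is exact. -/
theorem even_kappa (μ : YoungDiagram) : Even (kappa μ) := by
  rw [kappa, card_eq_sum_rowLen, Nat.cast_sum, ← Finset.sum_add_distrib]
  refine Finset.even_sum _ fun i _ => ?_
  obtain ⟨k, hk⟩ := Int.even_mul_succ_self (μ.rowLen i : ℤ)
  exact ⟨k - ((i : ℤ) + 1) * μ.rowLen i, by linear_combination hk⟩

section Specialization

variable {R : Type*} [CommRing R]

/-- The value `e_n` of the elementary symmetric function under the specialization with generating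
series `E(t) = ∑ e_n tⁿ`, with `e_n = 0` for `n < 0`. -/
def elem (E : R⟦X⟧) (n : ℤ) : R :=
  if 0 ≤ n then coeff n.toNat E else 0

/-- The skew Schur function `s_{α/β}(E(t)) = det (e_{α'ᵢ - β'ⱼ - i + j})` under the specialization
with `E(t) = ∑ e_n tⁿ`. The size of the determinant is the larger of `l(α')` and `l(β')`. -/
def skewSchur (E : R⟦X⟧) (α β : YoungDiagram) : R :=
  Matrix.det (Matrix.of fun i j : Fin (max (α.rowLen 0) (β.rowLen 0)) =>
    elem E ((α.colLen i : ℤ) - (β.colLen j : ℤ) - (i : ℤ) + (j : ℤ)))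

/-- The Schur function `s_α(E(t)) = s_{α/∅}(E(t))`. -/
def schur (E : R⟦X⟧) (α : YoungDiagram) : R :=
  skewSchur E α ⊥

end Specialization

/-- Semistandard tableaux of skew shape `α/β`: fillings of the cells of `α` outside `β` by natural
numbers, weakly increasing along rows and strictly increasing down columns, and extended by `0`. -/
@[ext]
structure SkewTableau (α β : YoungDiagram) where
  entry : ℕ → ℕ → ℕ
  row_weak : ∀ {i j₁ j₂ : ℕ}, j₁ < j₂ → (i, j₁) ∉ β → (i, j₂) ∈ α → entry i j₁ ≤ entry i j₂
  col_strict : ∀ {i₁ i₂ j : ℕ}, i₁ < i₂ → (i₁, j) ∉ β → (i₂, j) ∈ α → entry i₁ j < entry i₂ j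
  zeros : ∀ {i j : ℕ}, (i, j) ∉ α ∨ (i, j) ∈ β → entry i j = 0

/-- The skew Schur function in the infinitely many variables `x₀, x₁, x₂, …` converges (absolutely)
and has the value `v` at the complex sequence `x`: the sum over all semistandard tableaux `T` of
shape `α/β` (with `β ⊆ α`) of the monomials `∏ x_{T(c)}`. -/
def HasSkewSchurValue (x : ℕ → ℂ) (α β : YoungDiagram) (v : ℂ) : Prop :=
  HasSum (fun T : SkewTableau α β => ∏ c ∈ α.cells \ β.cells, x (T.entry c.1 c.2)) v

section RationalFunctions

variable {K : Type*} [Field K]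

/-- `E(t) = ∏_{i ≥ 1} (1 + q^{i-1} t) = ∑ₙ q^{n(n-1)/2} tⁿ / ∏_{i=1}^n (1 - qⁱ)`, the generating
series of the `e_n(1, q, q², …)` as rational functions of `q`. -/
def principalSeries (q : K) : K⟦X⟧ :=
  PowerSeries.mk fun n => q ^ (n * (n - 1) / 2) / ∏ i ∈ Finset.Icc 1 n, (1 - q ^ i)

/-- `s_{α/β}(1, q, q², …)` as a rational function of `q`. -/
def principalSkewSchur (q : K) (α β : YoungDiagram) : K :=
  skewSchur (principalSeries q) α β

/-- `𝓔_μ(q,t) = ∏_{j=1}^{l(μ)} (1 + q^{μ_j-j} t) / (1 + q^{-j} t) ·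
(1 + ∑_{n ≥ 1} tⁿ / ∏_{i=1}^n (qⁱ - 1))`. -/
def calE (q : K) (μ : YoungDiagram) : K⟦X⟧ :=
  (∏ j ∈ Finset.range (μ.colLen 0),
    ((1 + C (q ^ ((μ.rowLen j : ℤ) - ((j : ℤ) + 1))) * X) *
      (1 + C (q ^ (-((j : ℤ) + 1))) * X)⁻¹)) *
  PowerSeries.mk fun n => 1 / ∏ i ∈ Finset.Icc 1 n, (q ^ i - 1)

/-- `[m] = q^{m/2} - q^{-m/2}`, where `r = q^{1/2}`. -/
def bracket (r : K) (m : ℤ) : K :=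
  r ^ m - r ^ (-m)

/-- `𝓦_μ = q^{κ_μ/4} ∏_{1 ≤ i < j ≤ l(μ)} [μ_i - μ_j + j - i] / [j - i] ·
∏_{i=1}^{l(μ)} ∏_{v=1}^{μ_i} 1 / [v - i + l(μ)]`, where `r = q^{1/2}`. -/
def calW₁ (r : K) (μ : YoungDiagram) : K :=
  r ^ (kappa μ / 2) *
  (∏ j ∈ Finset.range (μ.colLen 0), ∏ i ∈ Finset.range j,
    bracket r ((μ.rowLen i : ℤ) - (μ.rowLen j : ℤ) + (j : ℤ) - (i : ℤ)) /
      bracket r ((j : ℤ) - (i : ℤ))) *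
  ∏ i ∈ Finset.range (μ.colLen 0), ∏ v ∈ Finset.Icc 1 (μ.rowLen i),
    1 / bracket r ((v : ℤ) - ((i : ℤ) + 1) + (μ.colLen 0 : ℤ))

/-- `𝓦_{μ,ν} = q^{|ν|/2} 𝓦_μ s_ν(𝓔_μ(q,t))`, where `r = q^{1/2}`. -/
def calW (r : K) (μ ν : YoungDiagram) : K :=
  r ^ ν.card * calW₁ r μ * schur (calE (r ^ 2) μ) ν

end RationalFunctions

end ZhouW

end

/-!
All identities come from one determinant evaluation. For diagrams with at most `m` columns put
`aᵢ = μ'ᵢ + m - i` and `bᵢ = ν'ᵢ + m - i` (`beta`), let `eₙ` be the coefficients of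
`∏_{i ≥ 1} (1 + q^{i-1} t)`, and consider the symmetric kernel `S(a, b) = ∑ₙ q⁻ⁿ e_{a-n} e_{b-n}`.

* By the Cauchy–Binet formula (`det_sum_eq_sum_boxDiagrams`), `det S(aₖ, bᵢ)` is, up to a power of
  `q`, the sum `∑_ρ q^{-|ρ|} s_{μ/ρ} s_{ν/ρ}`, since the `m`-subsets of the natural numbers are
  exactly the sequences attached to the diagrams `ρ` with at most `m` columns.
* Passing from rows to columns, `𝓔_μ` becomes, after rescaling `t`, the product of the factors
  `1 + q^{-j} t` over all `j ≥ 0` that do not occur among the `aₖ` (`rescale_calE_mul_prod`).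
  Multiplying it by all factors `1 + q^{-aₗ} t` with `l ≠ k` leaves the product over `j ≠ aₖ`,
  which depends on `aₖ` alone. Hence the determinant of the coefficients of order `bᵢ` of these
  products is `s_ν(𝓔_μ)` times a factor that depends only on `μ` (`det_coeff_eq_skewSchur_mul`).
* The coefficient of order `b` of the product over `j ≠ a` is `S(a, b) / eₐ` up to a sign and a
  power of `q` depending on `b` only (`coeff_punctured`): both sides satisfy the same recursion.

Comparing `ν` with the empty shape eliminates the factor that depends on `μ` and gives
`s_μ s_ν(𝓔_μ) = ± q^{κ_ν/2} ∑_ρ q^{-|ρ|} s_{μ/ρ} s_{ν/ρ}` (`schur_calE`). The formula for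
`𝓦_{μ,ν}` follows because both `s_μ(1, q, …)`, a Vandermonde determinant in the columns of `μ`,
and `𝓦_μ`, a product over the rows of `μ`, are given by hook lengths (`prod_Icc_eq_prod_hooks`);
its right-hand side is visibly symmetric.

For the convergence statements, the tableaux with entries `< n` sum to the determinant in the
elementary symmetric polynomials of `n` variables (`sum_boundedTableaux`): removing the largest
entries of a tableau corresponds to the Cauchy–Binet expansion of a product of two Toeplitz
matrices, one of them bidiagonal. Applied to the absolute values of the variables this bounds the
partial sums, and the limit is found coefficientwise (`hasSkewSchurValue_of_tendsto`).
-/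

noncomputable section

namespace ZhouW

/-! ### Young diagrams through their column lengths -/

theorem ext_colLen {ρ σ : YoungDiagram} (h : ∀ j, ρ.colLen j = σ.colLen j) : ρ = σ := by
  ext ⟨i, j⟩
  rw [YoungDiagram.mem_cells, YoungDiagram.mem_cells, YoungDiagram.mem_iff_lt_colLen,
    YoungDiagram.mem_iff_lt_colLen, h]

theorem le_iff_colLen {ρ σ : YoungDiagram} : ρ ≤ σ ↔ ∀ j, ρ.colLen j ≤ σ.colLen j := by
  constructor
  · intro h j
    by_contra! hlt
    exact lt_irrefl _ (YoungDiagram.mem_iff_lt_colLen.1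
      (h (YoungDiagram.mem_iff_lt_colLen.2 hlt)))
  · rintro h ⟨i, j⟩ hc
    exact YoungDiagram.mem_iff_lt_colLen.2
      ((YoungDiagram.mem_iff_lt_colLen.1 hc).trans_le (h j))

theorem colLen_eq_zero_iff {ρ : YoungDiagram} {j : ℕ} : ρ.colLen j = 0 ↔ ρ.rowLen 0 ≤ j := by
  rw [← not_iff_not, not_le, ← YoungDiagram.mem_iff_lt_rowLen, YoungDiagram.mem_iff_lt_colLen,
    Nat.pos_iff_ne_zero]

theorem colLen_bot (j : ℕ) : (⊥ : YoungDiagram).colLen j = 0 := by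
  by_contra h
  exact YoungDiagram.notMem_bot (0, j)
    (YoungDiagram.mem_iff_lt_colLen.2 (Nat.pos_of_ne_zero h))

theorem rowLen_bot (i : ℕ) : (⊥ : YoungDiagram).rowLen i = 0 := by
  by_contra h
  exact YoungDiagram.notMem_bot (i, 0)
    (YoungDiagram.mem_iff_lt_rowLen.2 (Nat.pos_of_ne_zero h))

theorem rowLen_mono {ρ σ : YoungDiagram} (h : ρ ≤ σ) (i : ℕ) : ρ.rowLen i ≤ σ.rowLen i := by
  by_contra! hlt
  exact lt_irrefl _ (YoungDiagram.mem_iff_lt_rowLen.1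
    (h (YoungDiagram.mem_iff_lt_rowLen.2 hlt)))

/-- The cells of a Young diagram with at most `m` columns, listed column by column. -/
theorem prod_cells_eq_prod_cols {M : Type*} [CommMonoid M] (μ : YoungDiagram) {m : ℕ}
    (hm : μ.rowLen 0 ≤ m) (f : ℕ × ℕ → M) :
    ∏ c ∈ μ.cells, f c = ∏ j ∈ Finset.range m, ∏ i ∈ Finset.range (μ.colLen j), f (i, j) := by
  rw [Finset.prod_sigma']
  refine Finset.prod_nbij' (fun c => ⟨c.2, c.1⟩) (fun c => (c.2, c.1)) ?_ ?_ ?_ ?_ ?_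
  · rintro ⟨i, j⟩ hc
    have hc' := (YoungDiagram.mem_cells _).1 hc
    simp only [Finset.mem_sigma, Finset.mem_range]
    refine ⟨lt_of_lt_of_le ?_ hm, YoungDiagram.mem_iff_lt_colLen.1 hc'⟩
    exact YoungDiagram.mem_iff_lt_rowLen.1 (μ.up_left_mem (Nat.zero_le i) le_rfl hc')
  · rintro ⟨j, i⟩ hc
    simp only [Finset.mem_sigma, Finset.mem_range] at hc
    exact (YoungDiagram.mem_cells _).2 (YoungDiagram.mem_iff_lt_colLen.2 hc.2)
  all_goals intros; rfl

/-- The cells of a Young diagram with at most `n` rows, listed row by row. -/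
theorem prod_cells_eq_prod_rows {M : Type*} [CommMonoid M] (μ : YoungDiagram) {n : ℕ}
    (hn : μ.colLen 0 ≤ n) (f : ℕ × ℕ → M) :
    ∏ c ∈ μ.cells, f c = ∏ i ∈ Finset.range n, ∏ j ∈ Finset.range (μ.rowLen i), f (i, j) := by
  rw [Finset.prod_sigma']
  refine Finset.prod_nbij' (fun c => ⟨c.1, c.2⟩) (fun c => (c.1, c.2)) ?_ ?_ ?_ ?_ ?_
  · rintro ⟨i, j⟩ hc
    have hc' := (YoungDiagram.mem_cells _).1 hc
    simp only [Finset.mem_sigma, Finset.mem_range]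
    refine ⟨lt_of_lt_of_le ?_ hn, YoungDiagram.mem_iff_lt_rowLen.1 hc'⟩
    exact YoungDiagram.mem_iff_lt_colLen.1 (μ.up_left_mem le_rfl (Nat.zero_le j) hc')
  · rintro ⟨i, j⟩ hc
    simp only [Finset.mem_sigma, Finset.mem_range] at hc
    exact (YoungDiagram.mem_cells _).2 (YoungDiagram.mem_iff_lt_rowLen.2 hc.2)
  all_goals intros; rfl

theorem sum_cells_eq_sum_cols {M : Type*} [AddCommMonoid M] (μ : YoungDiagram) {m : ℕ}
    (hm : μ.rowLen 0 ≤ m) (f : ℕ × ℕ → M) :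
    ∑ c ∈ μ.cells, f c = ∑ j ∈ Finset.range m, ∑ i ∈ Finset.range (μ.colLen j), f (i, j) :=
  prod_cells_eq_prod_cols (M := Multiplicative M) μ hm f

theorem sum_cells_eq_sum_rows {M : Type*} [AddCommMonoid M] (μ : YoungDiagram) {n : ℕ}
    (hn : μ.colLen 0 ≤ n) (f : ℕ × ℕ → M) :
    ∑ c ∈ μ.cells, f c = ∑ i ∈ Finset.range n, ∑ j ∈ Finset.range (μ.rowLen i), f (i, j) :=
  prod_cells_eq_prod_rows (M := Multiplicative M) μ hn f

theorem card_eq_sum_colLen (μ : YoungDiagram) {m : ℕ} (hm : μ.rowLen 0 ≤ m) :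
    μ.card = ∑ j ∈ Finset.range m, μ.colLen j := by
  have h := sum_cells_eq_sum_cols μ hm fun _ => 1
  simpa using h

/-- The strictly decreasing sequence `ρ'₁ + m - 1 > ρ'₂ + m - 2 > … > ρ'ₘ` attached to a Young
diagram `ρ` with at most `m` columns. -/
def beta (m : ℕ) (ρ : YoungDiagram) (k : Fin m) : ℕ :=
  ρ.colLen k + (m - 1 - k)

theorem beta_strictAnti (m : ℕ) (ρ : YoungDiagram) : StrictAnti (beta m ρ) := by
  intro i j hij
  have h1 := ρ.colLen_anti i j hij.le
  have h2 : (i : ℕ) < j := hij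
  have h3 := j.2
  simp only [beta]
  omega

theorem sum_beta (m : ℕ) (ρ : YoungDiagram) (h : ρ.rowLen 0 ≤ m) :
    ∑ k, beta m ρ k = ρ.card + ∑ k : Fin m, (m - 1 - (k : ℕ)) := by
  rw [card_eq_sum_colLen ρ h, Finset.sum_range, ← Finset.sum_add_distrib]
  rfl

/-- The Young diagrams with at most `m` columns whose decreasing sequence is bounded by `N`. -/
def boxDiagrams (m N : ℕ) : Set YoungDiagram :=
  {ρ | ρ.rowLen 0 ≤ m ∧ ∀ k, beta m ρ k < N}

theorem boxDiagrams_finite (m N : ℕ) : (boxDiagrams m N).Finite := by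
  refine Set.Finite.of_finite_image (f := YoungDiagram.cells)
    (((Finset.range N ×ˢ Finset.range m).powerset.finite_toSet).subset ?_) ?_
  · rintro _ ⟨ρ, ⟨h1, h2⟩, rfl⟩
    rw [Finset.mem_coe, Finset.mem_powerset]
    rintro ⟨i, j⟩ hc
    rw [YoungDiagram.mem_cells] at hc
    have hj : j < m := lt_of_lt_of_le (YoungDiagram.mem_iff_lt_rowLen.1
      (ρ.up_left_mem (Nat.zero_le i) le_rfl hc)) h1
    have hi := YoungDiagram.mem_iff_lt_colLen.1 hc
    have := h2 ⟨j, hj⟩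
    simp only [beta] at this
    rw [Finset.mem_product, Finset.mem_range, Finset.mem_range]
    exact ⟨by dsimp only; omega, hj⟩
  · intro ρ _ σ _ h
    exact YoungDiagram.ext h

/-- The Young diagram with prescribed column lengths `l 0, l 1, …, l (m - 1)`. -/
def ofColLens (l : ℕ → ℕ) (hl : Antitone l) (m : ℕ) : YoungDiagram where
  cells := (Finset.range (l 0) ×ˢ Finset.range m).filter fun c => c.1 < l c.2
  isLowerSet := by
    rintro ⟨i, j⟩ ⟨i', j'⟩ ⟨hi, hj⟩ h
    simp only [Finset.coe_filter, Finset.mem_product, Finset.mem_range, Set.mem_ofPred_eq] at h ⊢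
    have := hl hj
    simp only at hi hj this
    omega

theorem colLen_ofColLens (l : ℕ → ℕ) (hl : Antitone l) (m : ℕ) (hm : l m = 0) (j : ℕ) :
    (ofColLens l hl m).colLen j = l j := by
  have key : ∀ i, i < (ofColLens l hl m).colLen j ↔ i < l j := by
    intro i
    rw [← YoungDiagram.mem_iff_lt_colLen, ← YoungDiagram.mem_cells]
    simp only [ofColLens, Finset.mem_filter, Finset.mem_product, Finset.mem_range]
    refine ⟨fun h => h.2, fun h => ⟨⟨h.trans_le (hl (Nat.zero_le j)), ?_⟩, h⟩⟩
    by_contra! hj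
    have := hl hj
    omega
  have h1 := key (l j)
  have h2 := key ((ofColLens l hl m).colLen j)
  omega

/-- Every strictly decreasing sequence of length `m` comes from a Young diagram. -/
theorem exists_beta_eq {m : ℕ} {c : Fin m → ℕ} (hc : StrictAnti c) :
    ∃ ρ : YoungDiagram, ρ.rowLen 0 ≤ m ∧ beta m ρ = c := by
  have step : ∀ i j : Fin m, i ≤ j → c j + ((j : ℕ) - i) ≤ c i := by
    intro i j
    obtain ⟨j, hj⟩ := j
    induction j with
    | zero => intro h; have : i = ⟨0, hj⟩ := le_antisymm h (Nat.zero_le _); subst this; simp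
    | succ j ih =>
      intro h
      rcases eq_or_lt_of_le h with h | h
      · subst h; simp
      · have h1 : (i : ℕ) < j + 1 := h
        have h2 := ih (by omega) (show (i : ℕ) ≤ j by omega)
        have h3 : c ⟨j + 1, hj⟩ < c ⟨j, by omega⟩ := hc (Nat.lt_succ_self j)
        simp only at h2 ⊢
        omega
  have hlow : ∀ k : Fin m, m - 1 - k ≤ c k := by
    intro k
    have hk := k.2
    have := step k ⟨m - 1, by omega⟩ (show (k : ℕ) ≤ m - 1 by omega)
    simp only at this
    omega
  let l : ℕ → ℕ := fun k => if h : k < m then c ⟨k, h⟩ - (m - 1 - k) else 0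
  have hl : Antitone l := by
    intro i j hij
    simp only [l]
    by_cases hj : j < m
    · have := step ⟨i, by omega⟩ ⟨j, hj⟩ hij
      have h2 := hlow ⟨j, hj⟩
      rw [dif_pos hj, dif_pos (by omega)]
      simp only at this h2
      omega
    · simp [hj]
  have hlm : l m = 0 := by simp [l]
  refine ⟨ofColLens l hl m, ?_, ?_⟩
  · rw [← colLen_eq_zero_iff, colLen_ofColLens _ _ _ hlm, hlm]
  · funext k
    have := hlow k
    simp only [beta, colLen_ofColLens _ _ _ hlm, l, k.2, dif_pos, Fin.eta]
    omega

theorem beta_injOn {m : ℕ} {ρ σ : YoungDiagram} (hρ : ρ.rowLen 0 ≤ m) (hσ : σ.rowLen 0 ≤ m)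
    (h : beta m ρ = beta m σ) : ρ = σ := by
  refine ext_colLen fun j => ?_
  by_cases hj : j < m
  · have := congrFun h ⟨j, hj⟩
    simp only [beta] at this
    omega
  · rw [colLen_eq_zero_iff.2 (by omega), colLen_eq_zero_iff.2 (by omega)]

/-! ### The Cauchy–Binet formula, summed over Young diagrams -/

section CauchyBinet

variable {R : Type*} [CommRing R]

theorem det_sum_eq_sum_piFinset {m : ℕ} (N : ℕ) (A : Fin m → ℕ → R) (B : ℕ → Fin m → R) :
    Matrix.det (Matrix.of fun i j => ∑ n ∈ Finset.range N, A i n * B n j) =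
      ∑ f ∈ Fintype.piFinset fun _ : Fin m => Finset.range N,
        Matrix.det (Matrix.of fun i j => A i (f j)) * ∏ j, B (f j) j := by
  simp only [Matrix.det_apply', Matrix.of_apply, Finset.prod_univ_sum, Finset.mul_sum,
    Finset.sum_mul]
  rw [Finset.sum_comm]
  refine Finset.sum_congr rfl fun f _ => Finset.sum_congr rfl fun σ _ => ?_
  rw [Finset.prod_mul_distrib, mul_assoc]

/-- The Cauchy–Binet formula. The `m`-element subsets of `{0, …, N - 1}` are encoded by Young
diagrams with at most `m` columns. -/
theorem det_sum_eq_sum_boxDiagrams {m : ℕ} (N : ℕ) (A : Fin m → ℕ → R) (B : ℕ → Fin m → R) :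
    Matrix.det (Matrix.of fun i j => ∑ n ∈ Finset.range N, A i n * B n j) =
      ∑ ρ ∈ (boxDiagrams_finite m N).toFinset,
        Matrix.det (Matrix.of fun i k => A i (beta m ρ k)) *
          Matrix.det (Matrix.of fun k j => B (beta m ρ k) j) := by
  classical
  have expand : ∀ ρ : YoungDiagram,
      Matrix.det (Matrix.of fun i k => A i (beta m ρ k)) *
          Matrix.det (Matrix.of fun k j => B (beta m ρ k) j) =
        ∑ σ : Equiv.Perm (Fin m), Matrix.det (Matrix.of fun i j => A i (beta m ρ (σ j))) *
          ∏ j, B (beta m ρ (σ j)) j := by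
    intro ρ
    rw [Matrix.det_apply' (Matrix.of fun k j => B (beta m ρ k) j), Finset.mul_sum]
    refine Finset.sum_congr rfl fun σ _ => ?_
    have := Matrix.det_permute' σ (Matrix.of fun i k => A i (beta m ρ k))
    rw [show (Matrix.of fun i j => A i (beta m ρ (σ j))) =
      (Matrix.of fun i k => A i (beta m ρ k)).submatrix id σ from rfl, this]
    simp only [Matrix.of_apply]
    ring
  rw [det_sum_eq_sum_piFinset, Finset.sum_congr rfl fun ρ _ => expand ρ, ← Finset.sum_product']
  symm
  refine Finset.sum_of_injOn (fun p : YoungDiagram × Equiv.Perm (Fin m) => beta m p.1 ∘ p.2)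
    ?_ ?_ ?_ ?_
  · rintro ⟨ρ, σ⟩ h ⟨ρ', σ'⟩ h' heq
    simp only [Finset.coe_product, Set.Finite.coe_toFinset, Set.mem_prod, Finset.coe_univ,
      Set.mem_univ, and_true] at h h' heq
    have hr : Set.range (beta m ρ) = Set.range (beta m ρ') := by
      rw [← σ.surjective.range_comp (beta m ρ), heq, σ'.surjective.range_comp]
    have hb : beta m ρ = beta m ρ' := by
      have h1 : StrictMono (beta m ρ ∘ Fin.rev) :=
        (beta_strictAnti m ρ).comp Fin.rev_strictAnti
      have h2 : StrictMono (beta m ρ' ∘ Fin.rev) :=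
        (beta_strictAnti m ρ').comp Fin.rev_strictAnti
      have h3 := (h1.range_inj h2).1 (by
        rw [Fin.rev_surjective.range_comp, Fin.rev_surjective.range_comp, hr])
      exact Fin.rev_surjective.injective_comp_right h3
    have hρ := beta_injOn h.1 h'.1 hb
    subst hρ
    refine Prod.ext rfl (Equiv.ext fun j => ?_)
    exact (beta_strictAnti m ρ).injective (congrFun heq j)
  · rintro ⟨ρ, σ⟩ h
    simp only [Finset.coe_product, Set.Finite.coe_toFinset, Set.mem_prod, Finset.coe_univ,
      Set.mem_univ, and_true] at h
    simp only [Finset.mem_coe, Fintype.mem_piFinset, Finset.mem_range]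
    exact fun j => h.2 _
  · intro f hf hnot
    by_cases hinj : Function.Injective f
    · exfalso
      refine hnot ?_
      have hs : StrictMono (f ∘ Tuple.sort f) :=
        (Tuple.monotone_sort f).strictMono_of_injective (hinj.comp (Equiv.injective _))
      obtain ⟨ρ, hρ, hb⟩ := exists_beta_eq (hs.comp_strictAnti Fin.rev_strictAnti)
      refine ⟨(ρ, ((Fin.revPerm).trans (Tuple.sort f)).symm), ?_, ?_⟩
      · simp only [Finset.coe_product, Set.Finite.coe_toFinset, Set.mem_prod, Finset.coe_univ,
          Set.mem_univ, and_true]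
        refine ⟨hρ, fun k => ?_⟩
        rw [hb]
        exact Finset.mem_range.1 (Fintype.mem_piFinset.1 hf _)
      · funext j
        simp [hb]
    · rw [Function.Injective] at hinj
      push Not at hinj
      obtain ⟨i, j, hij, hne⟩ := hinj
      rw [Matrix.det_zero_of_column_eq hne, zero_mul]
      intro k
      simp [hij]
  · intro p _
    rfl

end CauchyBinet

/-! ### Skew Schur functions as minors of Toeplitz matrices -/

section Toeplitz

variable {R : Type*} [CommRing R]

theorem elem_of_neg (E : R⟦X⟧) {n : ℤ} (hn : n < 0) : elem E n = 0 :=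
  if_neg (by omega)

theorem elem_natCast (E : R⟦X⟧) (n : ℕ) : elem E n = coeff n E := by
  simp [elem]

theorem elem_zero (E : R⟦X⟧) : elem E 0 = constantCoeff E := by
  simp [elem]

theorem elem_natSub (E : R⟦X⟧) {a b : ℕ} (h : b ≤ a) : elem E ((a : ℤ) - b) = coeff (a - b) E := by
  rw [← Nat.cast_sub h, elem_natCast]

theorem det_of_last_row {m : ℕ} (M : Matrix (Fin (m + 1)) (Fin (m + 1)) R)
    (h : ∀ j : Fin m, M (Fin.last m) j.castSucc = 0) :
    M.det = M (Fin.last m) (Fin.last m) * (M.submatrix Fin.castSucc Fin.castSucc).det := by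
  rw [Matrix.det_succ_row M (Fin.last m), Fin.sum_univ_castSucc, Finset.sum_eq_zero]
  · have hs : ((-1 : R)) ^ (m + m) = 1 := Even.neg_one_pow ⟨m, rfl⟩
    have hc : (Fin.last m).succAbove = Fin.castSucc := by
      funext i; exact Fin.succAbove_last_apply i
    simp [hs, hc]
  · intro j _
    rw [h, mul_zero, zero_mul]

theorem det_of_last_col {m : ℕ} (M : Matrix (Fin (m + 1)) (Fin (m + 1)) R)
    (h : ∀ i : Fin m, M i.castSucc (Fin.last m) = 0) :
    M.det = M (Fin.last m) (Fin.last m) * (M.submatrix Fin.castSucc Fin.castSucc).det := by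
  rw [← Matrix.det_transpose, det_of_last_row M.transpose h, Matrix.transpose_apply,
    ← Matrix.det_transpose (M.submatrix _ _), Matrix.transpose_submatrix]

/-- The determinant of `skewSchur` does not depend on its size, as long as the latter is at least
the number of columns of both shapes. -/
theorem skewSchur_eq_det {E : R⟦X⟧} (hE : constantCoeff E = 1) {α β : YoungDiagram} {m : ℕ}
    (hα : α.rowLen 0 ≤ m) (hβ : β.rowLen 0 ≤ m) :
    skewSchur E α β =
      Matrix.det (Matrix.of fun i j : Fin m => elem E ((beta m α i : ℤ) - beta m β j)) := by
  have key : ∀ n, max (α.rowLen 0) (β.rowLen 0) ≤ n → skewSchur E α β =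
      Matrix.det (Matrix.of fun i j : Fin n =>
        elem E ((α.colLen i : ℤ) - (β.colLen j : ℤ) - (i : ℤ) + (j : ℤ))) := by
    intro n hn
    induction n, hn using Nat.le_induction with
    | base => rfl
    | succ n hn ih =>
      have h1 := colLen_eq_zero_iff.2 ((le_max_left _ _).trans hn)
      have h2 := colLen_eq_zero_iff.2 ((le_max_right _ _).trans hn)
      rw [ih, det_of_last_row]
      · have : elem E ((0 : ℤ) - 0 - n + n) = 1 := by
          rw [← hE, ← elem_zero]; congr 1; ring
        simp only [Matrix.of_apply, Fin.val_last, h1, h2, Nat.cast_zero, this, one_mul]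
        rfl
      · intro j
        refine elem_of_neg E ?_
        have := j.2
        simp only [Fin.val_last, h1, Fin.val_castSucc]
        omega
  rw [key m (max_le hα hβ)]
  congr 1
  ext i j
  have hi := i.2
  have hj := j.2
  simp only [Matrix.of_apply, beta]
  congr 1
  omega

theorem skewSchur_eq_zero_of_not_le {E : R⟦X⟧} (hE : constantCoeff E = 1) {α β : YoungDiagram}
    (h : ¬ β ≤ α) : skewSchur E α β = 0 := by
  rw [le_iff_colLen] at h
  push Not at h
  obtain ⟨j, hj⟩ := h
  have hβj : j < β.rowLen 0 := by
    rw [← not_le, ← colLen_eq_zero_iff]; omega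
  have hm := le_max_right (α.rowLen 0) (β.rowLen 0)
  generalize hm' : max (α.rowLen 0) (β.rowLen 0) = m at hm
  rw [skewSchur_eq_det hE (hm' ▸ le_max_left _ _) hm, Matrix.det_apply]
  refine Finset.sum_eq_zero fun σ _ => ?_
  -- a permutation cannot map `{0, …, j}` into `{0, …, j - 1}`
  obtain ⟨k, hk, hσ⟩ : ∃ k : Fin m, (k : ℕ) ≤ j ∧ j ≤ (σ k : ℕ) := by
    by_contra! hcon
    have hc := Finset.card_le_card_of_injOn (s := Finset.Iic (⟨j, by omega⟩ : Fin m))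
      (t := Finset.Iio (⟨j, by omega⟩ : Fin m)) σ
      (fun k hk => by
        have := Finset.mem_Iic.1 hk
        exact Finset.mem_coe.2 (Finset.mem_Iio.2 (hcon k this))) σ.injective.injOn
    simp at hc
  rw [Finset.prod_eq_zero (Finset.mem_univ k), smul_zero]
  refine elem_of_neg E ?_
  have h1 := α.colLen_anti _ _ hσ
  have h2 := β.colLen_anti _ _ hk
  have h3 := (σ k).2
  simp only [beta]
  omega

theorem elem_mul (E E' : R⟦X⟧) (a b : ℕ) {N : ℕ} (hN : a < N) :
    elem (E * E') ((a : ℤ) - b) =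
      ∑ n ∈ Finset.range N, elem E ((a : ℤ) - n) * elem E' ((n : ℤ) - b) := by
  by_cases hab : b ≤ a
  · rw [elem_natSub _ hab, coeff_mul]
    refine Finset.sum_of_injOn (fun p : ℕ × ℕ => b + p.2) ?_ ?_ ?_ ?_
    · rintro ⟨i, j⟩ h ⟨i', j'⟩ h' heq
      simp only [Finset.mem_coe, Finset.HasAntidiagonal.mem_antidiagonal] at h h' heq
      ext <;> simp only <;> omega
    · rintro ⟨i, j⟩ h
      simp only [Finset.mem_coe, Finset.HasAntidiagonal.mem_antidiagonal, Finset.mem_range] at h ⊢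
      omega
    · intro n _ hn
      by_cases h1 : n < b
      · rw [elem_of_neg E' (by omega), mul_zero]
      by_cases h2 : a < n
      · rw [elem_of_neg E (by omega), zero_mul]
      refine absurd ⟨(a - n, n - b), ?_, ?_⟩ hn
      · simp only [Finset.mem_coe, Finset.HasAntidiagonal.mem_antidiagonal]; omega
      · simp only; omega
    · rintro ⟨i, j⟩ h
      simp only [Finset.HasAntidiagonal.mem_antidiagonal] at h
      simp only
      rw [show (a : ℤ) - ((b + j : ℕ) : ℤ) = (i : ℕ) by omega,
        show ((b + j : ℕ) : ℤ) - b = (j : ℕ) by omega, elem_natCast, elem_natCast]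
  · rw [elem_of_neg _ (by omega), Finset.sum_eq_zero]
    intro n _
    by_cases h1 : n < b
    · rw [elem_of_neg E' (by omega), mul_zero]
    · rw [elem_of_neg E (by omega), zero_mul]

/-- The branching rule: multiplying the generating series amounts to uniting two sets of
variables. It is the Cauchy–Binet formula for a product of Toeplitz matrices. -/
theorem skewSchur_mul {E E' : R⟦X⟧} (hE : constantCoeff E = 1) (hE' : constantCoeff E' = 1)
    {α β : YoungDiagram} {m N : ℕ} (hα : α.rowLen 0 ≤ m) (hβ : β.rowLen 0 ≤ m)
    (hN : ∀ k, beta m α k < N) :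
    skewSchur (E * E') α β =
      ∑ γ ∈ (boxDiagrams_finite m N).toFinset, skewSchur E α γ * skewSchur E' γ β := by
  rw [skewSchur_eq_det (by rw [map_mul, hE, hE', one_mul]) hα hβ,
    Finset.sum_congr rfl fun γ hγ => by
      have hγ' : γ.rowLen 0 ≤ m := ((Set.Finite.mem_toFinset _).1 hγ).1
      rw [skewSchur_eq_det hE hα hγ', skewSchur_eq_det hE' hγ' hβ]]
  rw [← det_sum_eq_sum_boxDiagrams N (fun i n => elem E ((beta m α i : ℤ) - n))
    (fun n j => elem E' ((n : ℤ) - beta m β j))]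
  congr 1
  ext i j
  exact elem_mul E E' _ _ (hN i)

/-- The minors of a bidiagonal Toeplitz matrix. -/
theorem det_bidiagonal (w : ℤ → R) (hw : ∀ n, n ≠ 0 → n ≠ 1 → w n = 0) :
    ∀ {m : ℕ} (a c : Fin m → ℕ), StrictAnti a → StrictAnti c →
      Matrix.det (Matrix.of fun i j => w ((a i : ℤ) - c j)) = ∏ i, w ((a i : ℤ) - c i)
  | 0, _, _, _, _ => by simp
  | m + 1, a, c, ha, hc => by
    have ih := det_bidiagonal w hw (a ∘ Fin.castSucc) (c ∘ Fin.castSucc)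
      (ha.comp_strictMono Fin.strictMono_castSucc) (hc.comp_strictMono Fin.strictMono_castSucc)
    have main : Matrix.det (Matrix.of fun i j => w ((a i : ℤ) - c j)) =
        w ((a (Fin.last m) : ℤ) - c (Fin.last m)) *
          ((Matrix.of fun i j => w ((a i : ℤ) - c j)).submatrix
            Fin.castSucc Fin.castSucc).det := by
      -- in the last row or in the last column only the corner can be nonzero
      by_cases h : a (Fin.last m) ≤ c (Fin.last m)
      · refine det_of_last_row _ fun j => hw _ ?_ ?_ <;>
        · have := hc (Fin.castSucc_lt_last j)
          omega
      · refine det_of_last_col _ fun j => hw _ ?_ ?_ <;>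
        · have := ha (Fin.castSucc_lt_last j)
          omega
    rw [main, Fin.prod_univ_castSucc, mul_comm]
    congr 1

theorem elem_linear (x : R) (n : ℤ) :
    elem (1 + C x * X) n = if n = 0 then 1 else if n = 1 then x else 0 := by
  by_cases hn : 0 ≤ n
  · lift n to ℕ using hn
    rw [elem_natCast]
    rcases n with _ | _ | n
    · simp
    · simp [coeff_one]
    · rw [map_add, coeff_succ_mul_X, coeff_one, coeff_C, if_neg (by omega), if_neg (by omega),
        if_neg (by omega), if_neg (by omega), add_zero]
  · rw [elem_of_neg _ (by omega), if_neg (by omega), if_neg (by omega)]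

theorem skewSchur_linear (x : R) {α γ : YoungDiagram} {m : ℕ}
    (hα : α.rowLen 0 ≤ m) (hγ : γ.rowLen 0 ≤ m) :
    skewSchur (1 + C x * X) α γ =
      ∏ i ∈ Finset.range m, if α.colLen i = γ.colLen i then 1 else
        if α.colLen i = γ.colLen i + 1 then x else 0 := by
  rw [skewSchur_eq_det (by simp) hα hγ, det_bidiagonal (elem (1 + C x * X)) (fun n h0 h1 => by
    rw [elem_linear, if_neg h0, if_neg h1]) _ _ (beta_strictAnti m α) (beta_strictAnti m γ),
    Finset.prod_range]
  refine Finset.prod_congr rfl fun i _ => ?_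
  rw [elem_linear]
  refine if_congr ?_ rfl (if_congr ?_ rfl rfl) <;> simp only [beta] <;> omega

theorem skewSchur_one_self (α : YoungDiagram) : skewSchur (1 : R⟦X⟧) α α = 1 := by
  have h := skewSchur_linear (0 : R) (le_refl (α.rowLen 0)) le_rfl
  rw [map_zero, zero_mul, add_zero] at h
  simp [h]

theorem skewSchur_one_of_ne {α γ : YoungDiagram} (hne : α ≠ γ) :
    skewSchur (1 : R⟦X⟧) α γ = 0 := by
  have h := skewSchur_linear (0 : R) (le_max_left (α.rowLen 0) (γ.rowLen 0)) (le_max_right _ _)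
  rw [map_zero, zero_mul, add_zero] at h
  rw [h]
  obtain ⟨j, hj⟩ : ∃ j, α.colLen j ≠ γ.colLen j := by
    by_contra! hcon
    exact hne (ext_colLen hcon)
  refine Finset.prod_eq_zero (i := j) (Finset.mem_range.2 ?_) ?_
  · by_contra! hlt
    rw [max_le_iff] at hlt
    exact hj (by rw [colLen_eq_zero_iff.2 hlt.1, colLen_eq_zero_iff.2 hlt.2])
  · rw [if_neg hj, ite_self]

end Toeplitz

/-! ### Tableaux with bounded entries -/

/-- The tableaux with entries in `{0, …, n - 1}`. -/
def boundedTableaux (n : ℕ) (α β : YoungDiagram) : Set (SkewTableau α β) :=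
  {T | ∀ c ∈ α.cells \ β.cells, T.entry c.1 c.2 < n}

theorem SkewTableau.ext_of_cells {α β : YoungDiagram} {T T' : SkewTableau α β}
    (h : ∀ c ∈ α.cells \ β.cells, T.entry c.1 c.2 = T'.entry c.1 c.2) : T = T' := by
  ext i j
  by_cases hc : (i, j) ∈ α.cells \ β.cells
  · exact h _ hc
  · have : (i, j) ∉ α ∨ (i, j) ∈ β := by
      rw [Finset.mem_sdiff, YoungDiagram.mem_cells, YoungDiagram.mem_cells] at hc
      tauto
    rw [T.zeros this, T'.zeros this]

theorem boundedTableaux_finite (n : ℕ) (α β : YoungDiagram) : (boundedTableaux n α β).Finite := by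
  let f : boundedTableaux n α β → ((α.cells \ β.cells : Finset _) → Fin n) :=
    fun T c => ⟨T.1.entry c.1.1 c.1.2, T.2 c.1 c.2⟩
  refine Set.finite_coe_iff.1 (Finite.of_injective f ?_)
  intro T T' h
  refine Subtype.ext (SkewTableau.ext_of_cells fun c hc => ?_)
  exact congrArg Fin.val (congrFun h ⟨c, hc⟩)

/-- The shape formed by `β` and the cells of a tableau of shape `α/β` with entries `< n`. -/
def SkewTableau.inner {α β : YoungDiagram} (T : SkewTableau α β) (n : ℕ) : YoungDiagram where
  cells := α.cells.filter fun c => c ∈ β ∨ T.entry c.1 c.2 < n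
  isLowerSet := by
    rintro ⟨i, j⟩ ⟨i', j'⟩ ⟨hi, hj⟩ h
    simp only [Finset.coe_filter, YoungDiagram.mem_cells, Set.mem_ofPred_eq] at h hi hj ⊢
    refine ⟨α.up_left_mem hi hj h.1, ?_⟩
    by_cases hβ : (i', j') ∈ β
    · exact Or.inl hβ
    · right
      have h1 : (i, j') ∉ β := fun hc => hβ (β.up_left_mem hi le_rfl hc)
      have h2 : (i, j) ∉ β := fun hc => h1 (β.up_left_mem le_rfl hj hc)
      have h3 := h.2.resolve_left h2
      have h4 : T.entry i' j' ≤ T.entry i j' := by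
        rcases eq_or_lt_of_le hi with rfl | hi
        · exact le_rfl
        · exact (T.col_strict hi hβ (α.up_left_mem le_rfl hj h.1)).le
      have h5 : T.entry i j' ≤ T.entry i j := by
        rcases eq_or_lt_of_le hj with rfl | hj
        · exact le_rfl
        · exact T.row_weak hj h1 h.1
      omega

theorem SkewTableau.mem_inner {α β : YoungDiagram} (T : SkewTableau α β) (n : ℕ) (c : ℕ × ℕ) :
    c ∈ T.inner n ↔ c ∈ α ∧ (c ∈ β ∨ T.entry c.1 c.2 < n) := by
  rw [← YoungDiagram.mem_cells]
  simp [SkewTableau.inner]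

theorem SkewTableau.inner_le {α β : YoungDiagram} (T : SkewTableau α β) (n : ℕ) :
    T.inner n ≤ α := fun _ hc => ((T.mem_inner n _).1 hc).1

theorem SkewTableau.le_inner {α β : YoungDiagram} (h : β ≤ α) (T : SkewTableau α β) (n : ℕ) :
    β ≤ T.inner n := fun _ hc => (T.mem_inner n _).2 ⟨h hc, Or.inl hc⟩

/-- The largest entries of a tableau occupy at most one cell of each column. -/
theorem SkewTableau.colLen_le_inner {α β : YoungDiagram} {n : ℕ} {T : SkewTableau α β}
    (hT : T ∈ boundedTableaux (n + 1) α β) (j : ℕ) :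
    α.colLen j ≤ (T.inner n).colLen j + 1 := by
  by_contra! hlt
  have h0 : ((T.inner n).colLen j, j) ∉ T.inner n := fun hc =>
    lt_irrefl _ (YoungDiagram.mem_iff_lt_colLen.1 hc)
  have h1 : ((T.inner n).colLen j, j) ∈ α := YoungDiagram.mem_iff_lt_colLen.2 (by omega)
  have h2 : ((T.inner n).colLen j + 1, j) ∈ α := YoungDiagram.mem_iff_lt_colLen.2 hlt
  rw [T.mem_inner] at h0
  push Not at h0
  obtain ⟨h3, h4⟩ := h0 h1
  have h5 := T.col_strict (Nat.lt_add_one _) h3 h2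
  have h6 : ((T.inner n).colLen j + 1, j) ∉ β := fun hc =>
    h3 (β.up_left_mem (Nat.le_succ _) le_rfl hc)
  have h7 := hT ((T.inner n).colLen j + 1, j) (by
    rw [Finset.mem_sdiff, YoungDiagram.mem_cells, YoungDiagram.mem_cells]; exact ⟨h2, h6⟩)
  simp only at h4 h7
  omega

open Classical in
/-- The restriction of a tableau of shape `α/β` to a smaller shape `γ/β`. -/
def SkewTableau.restrict {α β : YoungDiagram} (T : SkewTableau α β) {γ : YoungDiagram}
    (h : γ ≤ α) : SkewTableau γ β where
  entry i j := if (i, j) ∈ γ then T.entry i j else 0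
  row_weak {i j₁ j₂} hj h₁ h₂ := by
    rw [if_pos h₂, if_pos (γ.up_left_mem le_rfl hj.le h₂)]
    exact T.row_weak hj h₁ (h h₂)
  col_strict {i₁ i₂ j} hi h₁ h₂ := by
    rw [if_pos h₂, if_pos (γ.up_left_mem hi.le le_rfl h₂)]
    exact T.col_strict hi h₁ (h h₂)
  zeros {i j} hc := by
    rcases hc with hc | hc
    · rw [if_neg hc]
    · rw [T.zeros (Or.inr hc), ite_self]

theorem SkewTableau.restrict_entry {α β : YoungDiagram} (T : SkewTableau α β) {γ : YoungDiagram}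
    (h : γ ≤ α) {i j : ℕ} (hc : (i, j) ∈ γ) : (T.restrict h).entry i j = T.entry i j :=
  if_pos hc

open Classical in
/-- The extension of a tableau with entries `< n` to a larger shape by the entry `n`, where the
larger shape has at most one more cell in each column. -/
def SkewTableau.extend {γ β : YoungDiagram} {n : ℕ} (T : SkewTableau γ β)
    (hT : T ∈ boundedTableaux n γ β) {α : YoungDiagram} (hβ : β ≤ γ) (hγ : γ ≤ α)
    (h : ∀ j, α.colLen j ≤ γ.colLen j + 1) : SkewTableau α β where
  entry i j := if (i, j) ∈ γ then T.entry i j else if (i, j) ∈ α then n else 0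
  row_weak {i j₁ j₂} hj h₁ h₂ := by
    by_cases h₃ : (i, j₂) ∈ γ
    · rw [if_pos h₃, if_pos (γ.up_left_mem le_rfl hj.le h₃)]
      exact T.row_weak hj h₁ h₃
    · rw [if_neg h₃, if_pos h₂]
      by_cases h₄ : (i, j₁) ∈ γ
      · rw [if_pos h₄]
        exact (hT (i, j₁) (by
          rw [Finset.mem_sdiff, YoungDiagram.mem_cells, YoungDiagram.mem_cells]
          exact ⟨h₄, h₁⟩)).le
      · rw [if_neg h₄]
        split_ifs <;> omega
  col_strict {i₁ i₂ j} hi h₁ h₂ := by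
    by_cases h₃ : (i₂, j) ∈ γ
    · rw [if_pos h₃, if_pos (γ.up_left_mem hi.le le_rfl h₃)]
      exact T.col_strict hi h₁ h₃
    · have h₄ : (i₁, j) ∈ γ := by
        rw [YoungDiagram.mem_iff_lt_colLen] at h₂ ⊢
        have := h j
        omega
      rw [if_neg h₃, if_pos h₂, if_pos h₄]
      exact hT (i₁, j) (by
        rw [Finset.mem_sdiff, YoungDiagram.mem_cells, YoungDiagram.mem_cells]
        exact ⟨h₄, h₁⟩)
  zeros {i j} hc := by
    by_cases h₃ : (i, j) ∈ γ
    · rw [if_pos h₃]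
      rcases hc with hc | hc
      · exact absurd (hγ h₃) hc
      · exact T.zeros (Or.inr hc)
    · rw [if_neg h₃]
      rcases hc with hc | hc
      · rw [if_neg hc]
      · exact absurd (hβ hc) h₃

section Sums

variable {R : Type*} [CommRing R]

/-- The monomial `∏ x_{T(c)}` of a tableau `T`. -/
def SkewTableau.monomial {α β : YoungDiagram} (T : SkewTableau α β) (x : ℕ → R) : R :=
  ∏ c ∈ α.cells \ β.cells, x (T.entry c.1 c.2)

theorem SkewTableau.monomial_eq_restrict {α β : YoungDiagram} {n : ℕ} {T : SkewTableau α β}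
    (hT : T ∈ boundedTableaux (n + 1) α β) (hβ : β ≤ T.inner n) (x : ℕ → R) :
    T.monomial x = x n ^ (α.card - (T.inner n).card) *
      (T.restrict (T.inner_le n)).monomial x := by
  have hsub : (T.inner n).cells ⊆ α.cells := YoungDiagram.cells_subset_iff.2 (T.inner_le n)
  have hβs : β.cells ⊆ (T.inner n).cells := YoungDiagram.cells_subset_iff.2 hβ
  have hunion : α.cells \ β.cells =
      (α.cells \ (T.inner n).cells) ∪ ((T.inner n).cells \ β.cells) := by
    ext c
    have h1 := @hsub c
    have h2 := @hβs c
    simp only [Finset.mem_union, Finset.mem_sdiff]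
    tauto
  have hdisj : Disjoint (α.cells \ (T.inner n).cells) ((T.inner n).cells \ β.cells) := by
    rw [Finset.disjoint_left]
    intro c h1 h2
    exact (Finset.mem_sdiff.1 h1).2 (Finset.mem_sdiff.1 h2).1
  rw [SkewTableau.monomial, hunion, Finset.prod_union hdisj]
  congr 1
  · rw [YoungDiagram.card, YoungDiagram.card, ← Finset.card_sdiff_of_subset hsub]
    refine Finset.prod_eq_pow_card fun c hc => ?_
    obtain ⟨hcα, hcγ⟩ := Finset.mem_sdiff.1 hc
    rw [YoungDiagram.mem_cells] at hcα hcγ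
    rw [T.mem_inner] at hcγ
    push Not at hcγ
    have hcβ := (hcγ hcα).1
    have h1 := (hcγ hcα).2
    have h2 := hT c (by
      rw [Finset.mem_sdiff, YoungDiagram.mem_cells, YoungDiagram.mem_cells]; exact ⟨hcα, hcβ⟩)
    rw [show T.entry c.1 c.2 = n by omega]
  · refine Finset.prod_congr rfl fun c hc => ?_
    rw [T.restrict_entry]
    exact (YoungDiagram.mem_cells _).1 (Finset.mem_sdiff.1 hc).1

/-- The tableaux of shape `α/β` with entries `≤ n` whose entries `< n` form a given shape `γ/β`
correspond to the tableaux of shape `γ/β` with entries `< n`. -/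
theorem sum_inner_eq {α β γ : YoungDiagram} {n : ℕ} (hβ : β ≤ γ) (hγ : γ ≤ α)
    (h : ∀ j, α.colLen j ≤ γ.colLen j + 1) [DecidableEq YoungDiagram] (x : ℕ → R) :
    ∑ T ∈ (boundedTableaux_finite (n + 1) α β).toFinset with T.inner n = γ, T.monomial x =
      x n ^ (α.card - γ.card) *
        ∑ T ∈ (boundedTableaux_finite n γ β).toFinset, T.monomial x := by
  rw [Finset.mul_sum]
  refine Finset.sum_nbij (fun T => T.restrict hγ) ?_ ?_ ?_ ?_
  · intro T hT
    rw [Finset.mem_filter, Set.Finite.mem_toFinset] at hT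
    obtain ⟨hT, rfl⟩ := hT
    rw [Set.Finite.mem_toFinset]
    intro c hc
    rw [Finset.mem_sdiff, YoungDiagram.mem_cells, YoungDiagram.mem_cells] at hc
    rw [T.restrict_entry _ hc.1]
    exact ((T.mem_inner n c).1 hc.1).2.resolve_left hc.2
  · intro T hT T' hT' heq
    rw [Finset.mem_coe, Finset.mem_filter, Set.Finite.mem_toFinset] at hT hT'
    refine SkewTableau.ext_of_cells fun c hc => ?_
    by_cases hcγ : c ∈ γ
    · have := congrArg (fun S => S.entry c.1 c.2) heq
      simp only at this
      rwa [T.restrict_entry _ hcγ, T'.restrict_entry _ hcγ] at this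
    · have h1 := hT.1 c hc
      have h2 := hT'.1 c hc
      rw [Finset.mem_sdiff, YoungDiagram.mem_cells, YoungDiagram.mem_cells] at hc
      have h3 := hcγ
      have h4 := hcγ
      rw [← hT.2, T.mem_inner] at h3
      rw [← hT'.2, T'.mem_inner] at h4
      push Not at h3 h4
      have h5 := (h3 hc.1).2
      have h6 := (h4 hc.1).2
      omega
  · intro T hT
    rw [Finset.mem_coe, Set.Finite.mem_toFinset] at hT
    have hin : ∀ i j, (i, j) ∈ γ → (T.extend hT hβ hγ h).entry i j = T.entry i j :=
      fun i j hc => if_pos hc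
    have hout : ∀ i j, (i, j) ∉ γ → (i, j) ∈ α → (T.extend hT hβ hγ h).entry i j = n :=
      fun i j hc hc' => (if_neg hc).trans (if_pos hc')
    refine ⟨T.extend hT hβ hγ h, ?_, ?_⟩
    · rw [Finset.mem_coe, Finset.mem_filter, Set.Finite.mem_toFinset]
      constructor
      · rintro ⟨i, j⟩ hc
        by_cases hcγ : (i, j) ∈ γ
        · simp only [hin i j hcγ]
          refine (hT (i, j) ?_).trans (Nat.lt_succ_self n)
          rw [Finset.mem_sdiff] at hc ⊢
          exact ⟨(YoungDiagram.mem_cells _).2 hcγ, hc.2⟩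
        · rw [Finset.mem_sdiff, YoungDiagram.mem_cells] at hc
          simp only [hout i j hcγ hc.1]
          omega
      · ext ⟨i, j⟩
        rw [YoungDiagram.mem_cells, YoungDiagram.mem_cells, SkewTableau.mem_inner]
        constructor
        · rintro ⟨hα, hc | hc⟩
          · exact hβ hc
          · by_contra hcγ
            simp only [hout i j hcγ hα] at hc
            omega
        · intro hc
          refine ⟨hγ hc, or_iff_not_imp_left.2 fun hcβ => ?_⟩
          simp only [hin i j hc]
          exact hT (i, j) (by
            rw [Finset.mem_sdiff, YoungDiagram.mem_cells, YoungDiagram.mem_cells]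
            exact ⟨hc, hcβ⟩)
    · refine SkewTableau.ext_of_cells fun c hc => ?_
      have hcγ := (YoungDiagram.mem_cells _).1 (Finset.mem_sdiff.1 hc).1
      simp only
      rw [SkewTableau.restrict_entry _ hγ hcγ]
      exact hin c.1 c.2 hcγ
  · intro T hT
    rw [Finset.mem_filter, Set.Finite.mem_toFinset] at hT
    obtain ⟨hT, rfl⟩ := hT
    exact T.monomial_eq_restrict hT hβ x

/-- The skew Schur polynomial in finitely many variables, as a sum over tableaux, is the
determinant in the elementary symmetric polynomials. -/
theorem sum_boundedTableaux (x : ℕ → R) (n : ℕ) {α β : YoungDiagram} (hβ : β ≤ α) :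
    ∑ T ∈ (boundedTableaux_finite n α β).toFinset, T.monomial x =
      skewSchur (∏ k ∈ Finset.range n, (1 + C (x k) * X)) α β := by
  classical
  induction n generalizing α with
  | zero =>
    rw [Finset.prod_range_zero]
    by_cases h : α = β
    · subst h
      rw [skewSchur_one_self]
      have hz : ∀ T : SkewTableau α α, T.monomial x = 1 := fun T => by
        rw [SkewTableau.monomial, sdiff_self]; rfl
      let T₀ : SkewTableau α α :=
        { entry := fun _ _ => 0
          row_weak := fun _ _ _ => le_rfl
          col_strict := fun hi h₁ h₂ => absurd (α.up_left_mem hi.le le_rfl h₂) h₁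
          zeros := fun _ => rfl }
      rw [Finset.sum_eq_single T₀, hz]
      · intro T _ hne
        exact absurd (SkewTableau.ext_of_cells fun c hc => by simp at hc) hne
      · intro hT
        refine absurd ((Set.Finite.mem_toFinset _).2 fun c hc => ?_) hT
        simp at hc
    · rw [skewSchur_one_of_ne h]
      refine Finset.sum_eq_zero fun T hT => ?_
      rw [Set.Finite.mem_toFinset] at hT
      have hlt : β.cells ⊂ α.cells :=
        YoungDiagram.cells_ssubset_iff.2 (lt_of_le_of_ne hβ (Ne.symm h))
      obtain ⟨c, hc⟩ := Finset.sdiff_nonempty.2 hlt.2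
      exact absurd (hT c hc) (Nat.not_lt_zero _)
  | succ n ih =>
    have hm : β.rowLen 0 ≤ α.rowLen 0 := rowLen_mono hβ 0
    have hN : ∀ k, beta (α.rowLen 0) α k < α.colLen 0 + α.rowLen 0 := by
      intro k
      have := k.2
      have := α.colLen_anti 0 k (Nat.zero_le _)
      simp only [beta]
      omega
    have hP : constantCoeff (∏ k ∈ Finset.range n, (1 + C (x k) * X)) = 1 := by
      simp [map_prod]
    rw [Finset.prod_range_succ, mul_comm, skewSchur_mul (by simp) hP le_rfl hm hN,
      ← Finset.sum_fiberwise_of_maps_to (g := fun T => T.inner n)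
        (t := (boxDiagrams_finite (α.rowLen 0) (α.colLen 0 + α.rowLen 0)).toFinset)]
    · refine Finset.sum_congr rfl fun γ hγ => ?_
      have hγm := ((Set.Finite.mem_toFinset _).1 hγ).1
      have hempty : (∀ T ∈ boundedTableaux (n + 1) α β, T.inner n ≠ γ) →
          ∑ T ∈ (boundedTableaux_finite (n + 1) α β).toFinset with T.inner n = γ,
            T.monomial x = 0 := by
        intro h
        rw [Finset.filter_false_of_mem, Finset.sum_empty]
        intro T hT
        exact h T ((Set.Finite.mem_toFinset _).1 hT)
      by_cases hβγ : β ≤ γ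
      · by_cases hstrip : γ ≤ α ∧ ∀ j, α.colLen j ≤ γ.colLen j + 1
        · rw [sum_inner_eq hβγ hstrip.1 hstrip.2, ih hβγ]
          congr 1
          rw [skewSchur_linear _ le_rfl hγm, card_eq_sum_colLen α le_rfl,
            card_eq_sum_colLen γ hγm,
            ← Finset.sum_tsub_distrib _ fun j _ => le_iff_colLen.1 hstrip.1 j,
            ← Finset.prod_pow_eq_pow_sum]
          refine Finset.prod_congr rfl fun j _ => ?_
          have h1 := le_iff_colLen.1 hstrip.1 j
          have h2 := hstrip.2 j
          by_cases h3 : α.colLen j = γ.colLen j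
          · simp [h3]
          · have h4 : α.colLen j = γ.colLen j + 1 := by omega
            rw [if_neg h3, if_pos h4, h4, Nat.add_sub_cancel_left, pow_one]
        · rw [hempty, skewSchur_linear _ le_rfl hγm]
          · obtain ⟨j, hj⟩ : ∃ j, α.colLen j < γ.colLen j ∨ γ.colLen j + 1 < α.colLen j := by
              by_contra! hcon
              exact hstrip ⟨le_iff_colLen.2 fun j => (hcon j).1, fun j => (hcon j).2⟩
            rw [Finset.prod_eq_zero (i := j), zero_mul]
            · rw [Finset.mem_range]
              by_contra! hlt
              have h1 := colLen_eq_zero_iff.2 hlt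
              have h2 := colLen_eq_zero_iff.2 (hγm.trans hlt)
              omega
            · rw [if_neg (by omega), if_neg (by omega)]
          · rintro T hT rfl
            exact hstrip ⟨T.inner_le n, T.colLen_le_inner hT⟩
      · rw [hempty, skewSchur_eq_zero_of_not_le hP hβγ, mul_zero]
        rintro T hT rfl
        exact hβγ (T.le_inner hβ n)
    · intro T hT
      rw [Set.Finite.mem_toFinset]
      refine ⟨rowLen_mono (T.inner_le n) 0, fun k => lt_of_le_of_lt ?_ (hN k)⟩
      exact Nat.add_le_add_right (le_iff_colLen.1 (T.inner_le n) k) _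

end Sums

/-! ### Convergence in infinitely many variables -/

section Convergence

open Filter Topology

theorem tendsto_skewSchur {R : Type*} [CommRing R] [TopologicalSpace R] [IsTopologicalRing R]
    {P : ℕ → R⟦X⟧} {E : R⟦X⟧}
    (h : ∀ k, Tendsto (fun n => coeff k (P n)) atTop (𝓝 (coeff k E))) (α β : YoungDiagram) :
    Tendsto (fun n => skewSchur (P n) α β) atTop (𝓝 (skewSchur E α β)) := by
  have hM : Continuous fun M : Matrix (Fin (max (α.rowLen 0) (β.rowLen 0)))
      (Fin (max (α.rowLen 0) (β.rowLen 0))) R => M.det := continuous_id.matrix_det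
  refine (hM.tendsto _).comp ?_
  refine tendsto_pi_nhds.2 fun i => tendsto_pi_nhds.2 fun j => ?_
  simp only [Matrix.of_apply, elem]
  split_ifs
  · exact h _
  · exact tendsto_const_nhds

/-- If the generating series of the elementary symmetric polynomials in `x₀, …, x_{n-1}` converge
coefficientwise, and so do those in `‖x₀‖, …, ‖x_{n-1}‖`, then the sum over tableaux converges
absolutely to the determinant. -/
theorem hasSkewSchurValue_of_tendsto {x : ℕ → ℂ} {E : ℂ⟦X⟧} {E' : ℝ⟦X⟧}
    (h : ∀ k, Tendsto (fun n => coeff k (∏ j ∈ Finset.range n, (1 + C (x j) * X))) atTop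
      (𝓝 (coeff k E)))
    (h' : ∀ k, Tendsto (fun n => coeff k (∏ j ∈ Finset.range n, (1 + C ‖x j‖ * X))) atTop
      (𝓝 (coeff k E')))
    {α β : YoungDiagram} (hβ : β ≤ α) : HasSkewSchurValue x α β (skewSchur E α β) := by
  let S : ℕ → Finset (SkewTableau α β) := fun n => (boundedTableaux_finite n α β).toFinset
  have hmono : Monotone S := by
    intro n n' hn T hT
    rw [Set.Finite.mem_toFinset] at hT ⊢
    exact fun c hc => (hT c hc).trans_le hn
  have hS : Tendsto S atTop atTop := by
    refine tendsto_atTop_finset_of_monotone hmono fun T => ?_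
    refine ⟨∑ c ∈ α.cells \ β.cells, (T.entry c.1 c.2 + 1), ?_⟩
    rw [Set.Finite.mem_toFinset]
    intro c hc
    exact Finset.single_le_sum (f := fun c : ℕ × ℕ => T.entry c.1 c.2 + 1)
      (fun _ _ => Nat.zero_le _) hc
  have hnorm : ∀ T : SkewTableau α β, ‖T.monomial x‖ = T.monomial fun k => ‖x k‖ :=
    fun T => by simp only [SkewTableau.monomial, norm_prod]
  have hsum : Summable fun T : SkewTableau α β => T.monomial x := by
    refine Summable.of_norm ?_
    obtain ⟨b, hb⟩ := (tendsto_skewSchur h' α β).bddAbove_range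
    refine summable_of_sum_le (c := b) (fun _ => norm_nonneg _) fun s => ?_
    obtain ⟨n, hn⟩ := (hS.eventually_ge_atTop s).exists
    calc ∑ T ∈ s, ‖T.monomial x‖ ≤ ∑ T ∈ S n, ‖T.monomial x‖ :=
          Finset.sum_le_sum_of_subset_of_nonneg hn fun _ _ _ => norm_nonneg _
      _ = skewSchur (∏ k ∈ Finset.range n, (1 + C ‖x k‖ * X)) α β := by
          rw [← sum_boundedTableaux _ n hβ]
          exact Finset.sum_congr rfl fun T _ => hnorm T
      _ ≤ b := hb ⟨n, rfl⟩
  have hlim : Tendsto (fun n => ∑ T ∈ S n, T.monomial x) atTop (𝓝 (skewSchur E α β)) := by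
    refine (tendsto_skewSchur h α β).congr fun n => ?_
    exact (sum_boundedTableaux x n hβ).symm
  have hval := tendsto_nhds_unique (hsum.hasSum.comp hS) hlim
  rw [HasSkewSchurValue, ← hval]
  exact hsum.hasSum

end Convergence

/-! ### The principal series and its functional equations -/

section Series

variable {K : Type*} [Field K]

theorem coeff_principalSeries_zero (q : K) : coeff 0 (principalSeries q) = 1 := by
  simp [principalSeries]

theorem constantCoeff_principalSeries (q : K) : constantCoeff (principalSeries q) = 1 := by
  rw [← coeff_zero_eq_constantCoeff_apply, coeff_principalSeries_zero]

theorem coeff_principalSeries_succ (q : K) (n : ℕ) :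
    coeff (n + 1) (principalSeries q) =
      q ^ n / (1 - q ^ (n + 1)) * coeff n (principalSeries q) := by
  rw [principalSeries, coeff_mk, coeff_mk, Nat.triangle_succ,
    Finset.prod_Icc_succ_top (Nat.le_add_left 1 n), pow_add, div_mul_div_comm]
  congr 1 <;> ring

/-- The series `∏_{j ≥ 1} (1 + q^{-j} t) = 1 + ∑_{n ≥ 1} tⁿ / ∏_{i=1}^n (qⁱ - 1)`. -/
def inversePrincipalSeries (q : K) : K⟦X⟧ :=
  PowerSeries.mk fun n => 1 / ∏ i ∈ Finset.Icc 1 n, (q ^ i - 1)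

theorem coeff_inversePrincipalSeries_zero (q : K) :
    coeff 0 (inversePrincipalSeries q) = 1 := by
  simp [inversePrincipalSeries]

theorem coeff_inversePrincipalSeries_succ (q : K) (n : ℕ) :
    coeff (n + 1) (inversePrincipalSeries q) =
      coeff n (inversePrincipalSeries q) / (q ^ (n + 1) - 1) := by
  rw [inversePrincipalSeries, coeff_mk, coeff_mk,
    Finset.prod_Icc_succ_top (Nat.le_add_left 1 n), div_div]

theorem calE_eq (q : K) (μ : YoungDiagram) :
    calE q μ = (∏ j ∈ Finset.range (μ.colLen 0),
      ((1 + C (q ^ ((μ.rowLen j : ℤ) - ((j : ℤ) + 1))) * X) *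
        (1 + C (q ^ (-((j : ℤ) + 1))) * X)⁻¹)) * inversePrincipalSeries q := rfl

theorem rescale_linear {R : Type*} [CommRing R] (a b : R) :
    rescale a (1 + C b * X) = 1 + C (b * a) * X := by
  ext n
  rw [coeff_rescale]
  rcases n with _ | _ | n
  · simp
  · simp [coeff_one, mul_comm]
  · simp [coeff_succ_mul_X, coeff_one]

theorem rescale_inv_principalSeries {q : K} (hq : q ≠ 0) (hroot : ∀ n : ℕ, 0 < n → q ^ n ≠ 1) :
    rescale q⁻¹ (principalSeries q⁻¹) = inversePrincipalSeries q := by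
  ext n
  rw [coeff_rescale]
  induction n with
  | zero => rw [coeff_principalSeries_zero, coeff_inversePrincipalSeries_zero, pow_zero, mul_one]
  | succ n ih =>
    have h1 : q ^ (n + 1) - 1 ≠ 0 := sub_ne_zero.2 (hroot _ (Nat.succ_pos n))
    have h2 : 1 - q⁻¹ ^ (n + 1) = (q ^ (n + 1) - 1) / q ^ (n + 1) := by
      rw [inv_pow]; field_simp
    rw [coeff_principalSeries_succ, coeff_inversePrincipalSeries_succ, ← ih, h2]
    generalize coeff n (principalSeries q⁻¹) = e
    simp only [inv_pow]
    field_simp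

/-- The finite form of the functional equation `E(t) = (1 + t) E(q t)` of the principal series. It
determines the coefficients recursively, which avoids Gaussian binomial coefficients. -/
theorem prod_linear_succ_eq_rescale {R : Type*} [CommRing R] (q : R) (n : ℕ) :
    (∏ j ∈ Finset.range n, (1 + C (q ^ j) * X)) * (1 + C (q ^ n) * X) =
      (1 + X) * rescale q (∏ j ∈ Finset.range n, (1 + C (q ^ j) * X)) := by
  rw [← Finset.prod_range_succ, Finset.prod_range_succ', map_prod, mul_comm]
  simp only [rescale_linear, ← pow_succ, pow_zero, map_one, one_mul]

theorem coeff_succ_prod_linear {q : K} {k : ℕ} (hk : q ^ (k + 1) ≠ 1) (n : ℕ) :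
    coeff (k + 1) (∏ j ∈ Finset.range n, (1 + C (q ^ j) * X)) =
      (q ^ k - q ^ n) / (1 - q ^ (k + 1)) *
        coeff k (∏ j ∈ Finset.range n, (1 + C (q ^ j) * X)) := by
  have h := congrArg (coeff (k + 1)) (prod_linear_succ_eq_rescale q n)
  generalize (∏ j ∈ Finset.range n, (1 + C (q ^ j) * X)) = P at h ⊢
  rw [mul_add, mul_one, add_mul, one_mul, map_add, map_add, ← mul_assoc, coeff_succ_mul_X,
    coeff_mul_C, coeff_succ_X_mul, coeff_rescale, coeff_rescale] at h
  have h1 : 1 - q ^ (k + 1) ≠ 0 := sub_ne_zero.2 (Ne.symm hk)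
  field_simp
  linear_combination h

end Series

section Limits

open Filter Topology

variable {𝕜 : Type*} [NormedField 𝕜]

theorem pow_ne_one_of_norm_lt_one {q : 𝕜} (hq : ‖q‖ < 1) {n : ℕ} (hn : 0 < n) : q ^ n ≠ 1 := by
  intro h
  have := congrArg norm h
  rw [norm_pow, norm_one] at this
  exact (pow_lt_one₀ (norm_nonneg q) hq hn.ne').ne this

theorem tendsto_coeff_principalSeries {q : 𝕜} (hq : ‖q‖ < 1) (k : ℕ) :
    Tendsto (fun n => coeff k (∏ j ∈ Finset.range n, (1 + C (q ^ j) * X))) atTop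
      (𝓝 (coeff k (principalSeries q))) := by
  induction k with
  | zero =>
    rw [coeff_principalSeries_zero]
    refine tendsto_const_nhds.congr fun n => ?_
    simp [map_prod]
  | succ k ih =>
    rw [coeff_principalSeries_succ]
    refine Tendsto.congr (fun n =>
      (coeff_succ_prod_linear (pow_ne_one_of_norm_lt_one hq (Nat.succ_pos k)) n).symm) ?_
    refine Tendsto.mul (Tendsto.div_const ?_ _) ih
    have := (tendsto_pow_atTop_nhds_zero_of_norm_lt_one hq).const_sub (q ^ k)
    rwa [sub_zero] at this

theorem tendsto_coeff_mul {R : Type*} [CommRing R] [TopologicalSpace R] [IsTopologicalRing R]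
    (A : R⟦X⟧) {P : ℕ → R⟦X⟧} {E : R⟦X⟧}
    (h : ∀ k, Tendsto (fun n => coeff k (P n)) atTop (𝓝 (coeff k E))) (k : ℕ) :
    Tendsto (fun n => coeff k (A * P n)) atTop (𝓝 (coeff k (A * E))) := by
  simp only [coeff_mul]
  exact tendsto_finsetSum _ fun p _ => (h p.2).const_mul _

theorem tendsto_coeff_calE {q : 𝕜} (hq : 1 < ‖q‖) (μ : YoungDiagram) (k : ℕ) :
    Tendsto (fun n => coeff k (∏ j ∈ Finset.range n,
      (1 + C (q ^ ((μ.rowLen j : ℤ) - ((j : ℤ) + 1))) * X))) atTop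
      (𝓝 (coeff k (calE q μ))) := by
  have hq0 : q ≠ 0 := by rintro rfl; simp at hq; linarith
  have hinv : ‖q⁻¹‖ < 1 := by rw [norm_inv]; exact inv_lt_one_of_one_lt₀ hq
  have hroot : ∀ n : ℕ, 0 < n → q ^ n ≠ 1 := by
    intro n hn h
    exact pow_ne_one_of_norm_lt_one hinv hn (by rw [inv_pow, h, inv_one])
  have hlim : ∀ k, Tendsto (fun n => coeff k (∏ j ∈ Finset.range n,
      (1 + C (q ^ (-((j : ℤ) + 1))) * X))) atTop (𝓝 (coeff k (inversePrincipalSeries q))) := by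
    intro k
    rw [← rescale_inv_principalSeries hq0 hroot, coeff_rescale]
    refine ((tendsto_coeff_principalSeries hinv k).const_mul (q⁻¹ ^ k)).congr fun n => ?_
    rw [← coeff_rescale, map_prod]
    simp only [rescale_linear]
    congr 1
    refine Finset.prod_congr rfl fun j _ => ?_
    rw [← pow_succ, inv_pow, zpow_neg]
    norm_cast
  rw [calE_eq]
  refine (tendsto_coeff_mul _ hlim k).congr' ?_
  filter_upwards [eventually_ge_atTop (μ.colLen 0)] with n hn
  congr 1
  rw [← Finset.prod_range_mul_prod_Ico _ hn, ← Finset.prod_range_mul_prod_Ico _ hn, ← mul_assoc,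
    ← Finset.prod_mul_distrib]
  congr 1
  · refine Finset.prod_congr rfl fun j _ => ?_
    rw [mul_assoc, PowerSeries.inv_mul_cancel _ (by simp), mul_one]
  · refine Finset.prod_congr rfl fun j hj => ?_
    have : μ.rowLen j = 0 := by
      rw [← YoungDiagram.colLen_transpose, colLen_eq_zero_iff, YoungDiagram.rowLen_transpose]
      exact (Finset.mem_Ico.1 hj).1
    rw [this, Nat.cast_zero, zero_sub]

theorem hasSkewSchurValue_principal {q : ℂ} (hq : ‖q‖ < 1) {α β : YoungDiagram} (hβ : β ≤ α) :
    HasSkewSchurValue (fun k : ℕ => q ^ k) α β (principalSkewSchur q α β) := by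
  refine hasSkewSchurValue_of_tendsto (E' := principalSeries ‖q‖)
    (tendsto_coeff_principalSeries hq) ?_ hβ
  simp only [norm_pow]
  exact tendsto_coeff_principalSeries (by rwa [norm_norm])

theorem hasSkewSchurValue_calE {q : ℂ} (hq : 1 < ‖q‖) (μ ν : YoungDiagram) :
    HasSkewSchurValue (fun k : ℕ => q ^ ((μ.rowLen k : ℤ) - ((k : ℤ) + 1))) ν ⊥
      (schur (calE q μ) ν) := by
  refine hasSkewSchurValue_of_tendsto (E' := calE ‖q‖ μ) (tendsto_coeff_calE hq μ) ?_ bot_le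
  simp only [norm_zpow]
  exact tendsto_coeff_calE (by rwa [norm_norm]) μ

end Limits

/-! ### The kernel `∑ₙ q⁻ⁿ e_{a-n} e_{b-n}` -/

section Kernel

variable {K : Type*} [Field K]

theorem rescale_inversePrincipalSeries {q : K} (hroot : ∀ n : ℕ, 0 < n → q ^ n ≠ 1) :
    rescale q (inversePrincipalSeries q) = (1 + X) * inversePrincipalSeries q := by
  ext n
  rw [coeff_rescale, add_mul, one_mul, map_add]
  rcases n with _ | n
  · simp
  · have h1 : q ^ (n + 1) - 1 ≠ 0 := sub_ne_zero.2 (hroot _ (Nat.succ_pos n))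
    rw [coeff_succ_X_mul, coeff_inversePrincipalSeries_succ]
    field_simp
    ring

theorem coeff_inversePrincipalSeries {q : K} (hq : q ≠ 0)
    (hroot : ∀ n : ℕ, 0 < n → q ^ n ≠ 1) (n : ℕ) :
    coeff n (inversePrincipalSeries q) =
      (-1) ^ n * q⁻¹ ^ (n * (n - 1) / 2) * coeff n (principalSeries q) := by
  induction n with
  | zero => simp [coeff_inversePrincipalSeries_zero, coeff_principalSeries_zero]
  | succ n ih =>
    have h1 : q ^ (n + 1) - 1 ≠ 0 := sub_ne_zero.2 (hroot _ (Nat.succ_pos n))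
    have h2 : 1 - q ^ (n + 1) = -(q ^ (n + 1) - 1) := by ring
    rw [coeff_inversePrincipalSeries_succ, coeff_principalSeries_succ, ih, Nat.triangle_succ, h2,
      pow_add q⁻¹, inv_pow q n]
    field_simp
    ring

/-- The series `∏_{j ≥ 0, j ≠ a} (1 + q^{-j} t)`, as the quotient of the full product by its factor
with `j = a`. -/
def punctured (q : K) (a : ℕ) : K⟦X⟧ :=
  rescale q (inversePrincipalSeries q) * (1 + C (q⁻¹ ^ a) * X)⁻¹

theorem punctured_mul (q : K) (a : ℕ) :
    punctured q a * (1 + C (q⁻¹ ^ a) * X) = rescale q (inversePrincipalSeries q) := by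
  rw [punctured, mul_assoc, PowerSeries.inv_mul_cancel _ (by simp), mul_one]

theorem linear_ne_zero {R : Type*} [CommRing R] [Nontrivial R] (y : R) :
    (1 + C y * X : R⟦X⟧) ≠ 0 := by
  intro h
  have := congrArg constantCoeff h
  simp at this

theorem eq_punctured {q : K} {a : ℕ} {P : K⟦X⟧}
    (h : P * (1 + C (q⁻¹ ^ a) * X) = rescale q (inversePrincipalSeries q)) :
    P = punctured q a :=
  mul_right_cancel₀ (linear_ne_zero (q⁻¹ ^ a)) (h.trans (punctured_mul q a).symm)

theorem punctured_zero {q : K} (hroot : ∀ n : ℕ, 0 < n → q ^ n ≠ 1) :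
    punctured q 0 = inversePrincipalSeries q := by
  refine (eq_punctured ?_).symm
  rw [rescale_inversePrincipalSeries hroot, pow_zero, map_one, one_mul, mul_comm]

theorem punctured_succ {q : K} (hq : q ≠ 0) (hroot : ∀ n : ℕ, 0 < n → q ^ n ≠ 1) (a : ℕ) :
    punctured q (a + 1) = inversePrincipalSeries q +
      C (1 - q⁻¹ ^ (a + 1)) * X * rescale q⁻¹ (punctured q a) := by
  refine (eq_punctured ?_).symm
  have h := congrArg (rescale q⁻¹) (punctured_mul q a)
  rw [map_mul, rescale_linear, ← pow_succ, rescale_rescale, mul_inv_cancel₀ hq, rescale_one,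
    RingHom.id_apply] at h
  rw [rescale_inversePrincipalSeries hroot, map_sub, map_one]
  linear_combination (1 - C (q⁻¹ ^ (a + 1))) * X * h

/-- The coefficients of `∏_{j ≥ 0, j ≠ a} (1 + q^{-j} t)` are, up to factors depending only on `a`
and only on the degree, given by a symmetric kernel. The induction on `a` compares
`punctured_succ` with the sum over `n ≥ 1` in the kernel, which is the kernel for `a - 1`
and `b - 1`. -/
theorem coeff_punctured {q : K} (hq : q ≠ 0) (hroot : ∀ n : ℕ, 0 < n → q ^ n ≠ 1) (a b : ℕ) :
    ∀ N, a < N → coeff a (principalSeries q) * coeff b (punctured q a) =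
      (-1) ^ b * q⁻¹ ^ (b * (b - 1) / 2) * ∑ n ∈ Finset.range N,
        elem (principalSeries q) ((b : ℤ) - n) *
          (q⁻¹ ^ n * elem (principalSeries q) ((a : ℤ) - n)) := by
  induction a generalizing b with
  | zero =>
    rintro (_ | N) hN
    · omega
    rw [punctured_zero hroot, coeff_principalSeries_zero, one_mul,
      coeff_inversePrincipalSeries hq hroot, Finset.sum_range_succ', Finset.sum_eq_zero]
    · have h0 : elem (principalSeries q) (((0 : ℕ) : ℤ) - ((0 : ℕ) : ℤ)) = 1 := by
        rw [sub_self, elem_zero, constantCoeff_principalSeries]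
      rw [h0, Nat.cast_zero, sub_zero, elem_natCast, pow_zero]
      ring
    · intro n _
      rw [elem_of_neg _ (show ((0 : ℕ) : ℤ) - ((n + 1 : ℕ) : ℤ) < 0 by omega), mul_zero, mul_zero]
  | succ a ih =>
    rintro (_ | N) hN
    · omega
    rcases b with _ | b
    · rw [Finset.sum_range_succ', Finset.sum_eq_zero]
      · have h0 : elem (principalSeries q) (((0 : ℕ) : ℤ) - ((0 : ℕ) : ℤ)) = 1 := by
          rw [sub_self, elem_zero, constantCoeff_principalSeries]
        have h1 : coeff 0 (punctured q (a + 1)) = 1 := by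
          rw [punctured_succ hq hroot, map_add, coeff_inversePrincipalSeries_zero]
          simp
        rw [h0, h1, Nat.cast_zero, sub_zero, elem_natCast]
        simp
      · intro n _
        rw [elem_of_neg _ (show ((0 : ℕ) : ℤ) - ((n + 1 : ℕ) : ℤ) < 0 by omega), zero_mul]
    · have h1 : 1 - q ^ (a + 1) ≠ 0 := sub_ne_zero.2 (Ne.symm (hroot _ (Nat.succ_pos a)))
      have hshift : ∀ n : ℕ,
          elem (principalSeries q) (((b + 1 : ℕ) : ℤ) - ((n + 1 : ℕ) : ℤ)) *
            (q⁻¹ ^ (n + 1) *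
              elem (principalSeries q) (((a + 1 : ℕ) : ℤ) - ((n + 1 : ℕ) : ℤ))) =
          q⁻¹ * (elem (principalSeries q) ((b : ℤ) - n) *
            (q⁻¹ ^ n * elem (principalSeries q) ((a : ℤ) - n))) := by
        intro n
        rw [show ((b + 1 : ℕ) : ℤ) - ((n + 1 : ℕ) : ℤ) = b - n by push_cast; ring,
          show ((a + 1 : ℕ) : ℤ) - ((n + 1 : ℕ) : ℤ) = a - n by push_cast; ring, pow_succ]
        ring
      have hfac : coeff (a + 1) (principalSeries q) * (1 - q⁻¹ ^ (a + 1)) =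
          -(q⁻¹ * coeff a (principalSeries q)) := by
        rw [coeff_principalSeries_succ, inv_pow]
        field_simp
        ring
      rw [Finset.sum_range_succ', Finset.sum_congr rfl fun n _ => hshift n, ← Finset.mul_sum,
        punctured_succ hq hroot, map_add, mul_assoc, coeff_C_mul, coeff_succ_X_mul,
        coeff_rescale, Nat.cast_zero, sub_zero, sub_zero, elem_natCast, elem_natCast,
        coeff_inversePrincipalSeries hq hroot, Nat.triangle_succ]
      have := ih b N (by omega)
      rw [pow_zero, pow_add q⁻¹, pow_succ (-1 : K) b]
      linear_combination (q⁻¹ ^ b * coeff b (punctured q a)) * hfac - q⁻¹ * q⁻¹ ^ b * this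

end Kernel

/-! ### Determinants of partial fractions -/

section PartialFractions

variable {R : Type*} [CommRing R]

theorem coeff_prod_linear_eq_zero {ι : Type*} (s : Finset ι) (y : ι → R) {n : ℕ}
    (hn : s.card < n) : coeff n (∏ l ∈ s, (1 + C (y l) * X)) = 0 := by
  classical
  induction s using Finset.induction_on generalizing n with
  | empty =>
    rw [Finset.card_empty] at hn
    rw [Finset.prod_empty, coeff_one, if_neg (by omega)]
  | insert i s hi ih =>
    rw [Finset.card_insert_of_notMem hi] at hn
    obtain ⟨n, rfl⟩ : ∃ k, n = k + 1 := ⟨n - 1, by omega⟩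
    rw [Finset.prod_insert hi, add_mul, one_mul, map_add, mul_assoc, coeff_C_mul,
      coeff_succ_X_mul, ih (by omega), ih (by omega), mul_zero, add_zero]

theorem coeff_mul_eq_sum_fin {m : ℕ} (G W : R⟦X⟧) (hW : ∀ n, m ≤ n → coeff n W = 0) (b : ℕ) :
    coeff b (G * W) = ∑ j : Fin m,
      elem G ((b : ℤ) - ((m - 1 - (j : ℕ) : ℕ) : ℤ)) * coeff (m - 1 - (j : ℕ)) W := by
  have h := elem_mul G W b 0 (N := m + (b + 1)) (by omega)
  rw [Nat.cast_zero, sub_zero, elem_natCast, Finset.sum_range_add, add_eq_left.2] at h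
  · rw [h, ← Finset.sum_range_reflect, Finset.sum_range]
    simp only [sub_zero, elem_natCast]
  · refine Finset.sum_eq_zero fun n _ => ?_
    rw [sub_zero, elem_natCast, hW _ (by omega), mul_zero]

/-- If the series `N_k` arise from `G` by multiplication with all but one of the factors
`1 + y_k t`, then the minors formed by their coefficients are Schur functions, up to a factor that
does not depend on the shape. -/
theorem det_coeff_eq_skewSchur_mul {m : ℕ} {G : R⟦X⟧} (hG : constantCoeff G = 1) (y : Fin m → R)
    {ν : YoungDiagram} (hν : ν.rowLen 0 ≤ m) :
    Matrix.det (Matrix.of fun i k : Fin m =>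
        coeff (beta m ν i) (G * ∏ l ∈ Finset.univ.erase k, (1 + C (y l) * X))) =
      schur G ν * Matrix.det (Matrix.of fun j k : Fin m =>
        coeff (m - 1 - (j : ℕ)) (∏ l ∈ Finset.univ.erase k, (1 + C (y l) * X))) := by
  rw [schur, skewSchur_eq_det hG hν (by rw [rowLen_bot]; exact Nat.zero_le m), ← Matrix.det_mul]
  congr 1
  ext i k
  rw [Matrix.of_apply, Matrix.mul_apply, coeff_mul_eq_sum_fin (m := m)]
  · simp only [Matrix.of_apply, beta, colLen_bot, zero_add]
  · intro n hn
    have := k.2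
    refine coeff_prod_linear_eq_zero _ _ ?_
    rw [Finset.card_erase_of_mem (Finset.mem_univ k), Finset.card_univ, Fintype.card_fin]
    omega

theorem elem_rescale {K : Type*} [Field K] (c : K) (E : K⟦X⟧) (n : ℤ) :
    elem (rescale c E) n = c ^ n * elem E n := by
  by_cases hn : 0 ≤ n
  · lift n to ℕ using hn
    rw [elem_natCast, elem_natCast, coeff_rescale, zpow_natCast]
  · rw [elem_of_neg _ (by omega), elem_of_neg _ (by omega), mul_zero]

/-- Schur functions are homogeneous. -/
theorem schur_rescale {K : Type*} [Field K] {c : K} (hc : c ≠ 0) {E : K⟦X⟧}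
    (hE : constantCoeff E = 1) (ν : YoungDiagram) :
    schur (rescale c E) ν = c ^ ν.card * schur E ν := by
  have hE' : constantCoeff (rescale c E) = 1 := by
    rw [← coeff_zero_eq_constantCoeff_apply, coeff_rescale, pow_zero, one_mul,
      coeff_zero_eq_constantCoeff_apply, hE]
  have hbot : (⊥ : YoungDiagram).rowLen 0 ≤ ν.rowLen 0 := by rw [rowLen_bot]; exact Nat.zero_le _
  rw [schur, schur, skewSchur_eq_det hE' le_rfl hbot, skewSchur_eq_det hE le_rfl hbot]
  have hM : (Matrix.of fun i j : Fin (ν.rowLen 0) =>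
      elem (rescale c E) ((beta _ ν i : ℤ) - beta _ ⊥ j)) =
      Matrix.of fun i j => c ^ beta (ν.rowLen 0) ν i * (Matrix.of fun i j =>
        (c ^ beta (ν.rowLen 0) ⊥ j)⁻¹ * (Matrix.of fun i j : Fin (ν.rowLen 0) =>
          elem E ((beta _ ν i : ℤ) - beta _ ⊥ j)) i j) i j := by
    ext i j
    simp only [Matrix.of_apply]
    rw [elem_rescale, zpow_sub₀ hc, zpow_natCast, zpow_natCast, div_eq_mul_inv, mul_assoc]
  rw [hM, Matrix.det_mul_column, Matrix.det_mul_row, ← mul_assoc, Finset.prod_inv_distrib,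
    Finset.prod_pow_eq_pow_sum, Finset.prod_pow_eq_pow_sum, sum_beta _ _ le_rfl,
    sum_beta _ _ hbot, pow_add]
  have h0 : (⊥ : YoungDiagram).card = 0 := rfl
  rw [h0, zero_add, mul_inv_cancel_right₀ (pow_ne_zero _ hc)]

end PartialFractions

/-! ### The series `𝓔_μ` in terms of the columns of `μ` -/

section CalE

variable {K : Type*} [Field K]

theorem inversePrincipalSeries_mul_prod {q : K} (hroot : ∀ n : ℕ, 0 < n → q ^ n ≠ 1) (m : ℕ) :
    inversePrincipalSeries q * ∏ k ∈ Finset.range m, (1 + C (q ^ (k : ℤ)) * X) =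
      rescale (q ^ m) (inversePrincipalSeries q) := by
  induction m with
  | zero => simp
  | succ m ih =>
    rw [Finset.prod_range_succ, ← mul_assoc, ih, pow_succ', ← rescale_rescale,
      rescale_inversePrincipalSeries hroot, map_mul, map_add, map_one, rescale_X, zpow_natCast,
      mul_comm]

/-- The rows and the columns of `μ` give the same rational function: both sides are products over
the cells of `μ` with telescoping rows or columns. -/
theorem prod_rows_mul_prod_cols {q : K} (μ : YoungDiagram) {m : ℕ} (hm : μ.rowLen 0 ≤ m) :
    (∏ j ∈ Finset.range (μ.colLen 0),
      ((1 + C (q ^ ((μ.rowLen j : ℤ) - ((j : ℤ) + 1))) * X) *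
        (1 + C (q ^ (-((j : ℤ) + 1))) * X)⁻¹)) *
      ∏ k ∈ Finset.range m, (1 + C (q ^ ((k : ℤ) - μ.colLen k)) * X) =
    ∏ k ∈ Finset.range m, (1 + C (q ^ (k : ℤ)) * X : K⟦X⟧) := by
  set L : ℤ → K⟦X⟧ := fun z => 1 + C (q ^ z) * X with hL
  have hL0 : ∀ z, L z ≠ 0 := fun z => linear_ne_zero _
  have hrows : (∏ j ∈ Finset.range (μ.colLen 0),
      (L ((μ.rowLen j : ℤ) - ((j : ℤ) + 1)) * (L (-((j : ℤ) + 1)))⁻¹)) *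
      ∏ c ∈ μ.cells, L ((c.2 : ℤ) - (c.1 + 1)) = ∏ c ∈ μ.cells, L ((c.2 : ℤ) - c.1) := by
    rw [prod_cells_eq_prod_rows μ le_rfl, prod_cells_eq_prod_rows μ le_rfl,
      ← Finset.prod_mul_distrib]
    refine Finset.prod_congr rfl fun i _ => ?_
    have h1 : L (-((i : ℤ) + 1)) * (L (-((i : ℤ) + 1)))⁻¹ = 1 :=
      PowerSeries.mul_inv_cancel _ (by simp [hL])
    have h2 := (Finset.prod_range_succ (fun j : ℕ => L ((j : ℤ) - (i + 1))) (μ.rowLen i)).symm.trans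
      (Finset.prod_range_succ' (fun j : ℕ => L ((j : ℤ) - (i + 1))) (μ.rowLen i))
    have h3 : ∀ j : ℕ, L (((j + 1 : ℕ) : ℤ) - (i + 1)) = L ((j : ℤ) - i) := fun j => by
      congr 1; push_cast; ring
    simp only [h3, Nat.cast_zero, zero_sub] at h2
    linear_combination (L (-((i : ℤ) + 1)))⁻¹ * h2 +
      (∏ j ∈ Finset.range (μ.rowLen i), L ((j : ℤ) - i)) * h1
  have hcols : (∏ c ∈ μ.cells, L ((c.2 : ℤ) - (c.1 + 1))) * ∏ k ∈ Finset.range m, L k =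
      (∏ c ∈ μ.cells, L ((c.2 : ℤ) - c.1)) *
        ∏ k ∈ Finset.range m, L ((k : ℤ) - μ.colLen k) := by
    rw [prod_cells_eq_prod_cols μ hm, prod_cells_eq_prod_cols μ hm, ← Finset.prod_mul_distrib,
      ← Finset.prod_mul_distrib]
    refine Finset.prod_congr rfl fun k _ => ?_
    have h2 := (Finset.prod_range_succ (fun i : ℕ => L ((k : ℤ) - i)) (μ.colLen k)).symm.trans
      (Finset.prod_range_succ' (fun i : ℕ => L ((k : ℤ) - i)) (μ.colLen k))
    simp only [Nat.cast_zero, sub_zero, Nat.cast_add, Nat.cast_one] at h2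
    exact h2.symm
  have hne : ∏ c ∈ μ.cells, L ((c.2 : ℤ) - (c.1 + 1)) ≠ 0 :=
    Finset.prod_ne_zero_iff.2 fun c _ => hL0 _
  refine mul_right_cancel₀ hne ?_
  rw [mul_right_comm, hrows, ← hcols, mul_comm]

theorem constantCoeff_calE (q : K) (μ : YoungDiagram) : constantCoeff (calE q μ) = 1 := by
  rw [calE_eq, map_mul, ← coeff_zero_eq_constantCoeff_apply (inversePrincipalSeries q),
    coeff_inversePrincipalSeries_zero, mul_one, map_prod]
  refine Finset.prod_eq_one fun j _ => ?_
  simp [PowerSeries.constantCoeff_inv]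

/-- After rescaling, `𝓔_μ` is the product of the `1 + q^{-j} t` over the nonnegative integers `j`
outside the decreasing sequence of `μ`. -/
theorem rescale_calE_mul_prod {q : K} (hq : q ≠ 0) (hroot : ∀ n : ℕ, 0 < n → q ^ n ≠ 1)
    (μ : YoungDiagram) {m : ℕ} (hm : μ.rowLen 0 ≤ m) (hm0 : 0 < m) :
    rescale ((q ^ (m - 1))⁻¹) (calE q μ) * ∏ k : Fin m, (1 + C (q⁻¹ ^ beta m μ k) * X) =
      rescale q (inversePrincipalSeries q) := by
  have h : calE q μ * ∏ k ∈ Finset.range m, (1 + C (q ^ ((k : ℤ) - μ.colLen k)) * X) =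
      rescale (q ^ m) (inversePrincipalSeries q) := by
    rw [calE_eq, mul_right_comm, prod_rows_mul_prod_cols μ hm, mul_comm,
      inversePrincipalSeries_mul_prod hroot]
  have h2 := congrArg (rescale ((q ^ (m - 1))⁻¹)) h
  obtain ⟨d, rfl⟩ : ∃ d, m = d + 1 := ⟨m - 1, by omega⟩
  rw [map_mul, map_prod, rescale_rescale, Nat.add_sub_cancel, pow_succ', mul_assoc,
    mul_inv_cancel₀ (pow_ne_zero _ hq), mul_one, Finset.prod_range] at h2
  rw [← h2, Nat.add_sub_cancel]
  congr 1
  refine Finset.prod_congr rfl fun k _ => ?_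
  rw [rescale_linear, beta, Nat.add_sub_cancel, inv_pow, ← zpow_natCast, ← zpow_natCast,
    ← zpow_neg, ← zpow_neg, ← zpow_add₀ hq]
  have := k.2
  congr 4
  omega

end CalE

/-! ### Hook lengths -/

section Hooks

/-- The hook length of a cell: the number of cells weakly to the right of it in its row or strictly
below it in its column. -/
def hook (μ : YoungDiagram) (c : ℕ × ℕ) : ℕ :=
  (μ.rowLen c.1 - 1 - c.2) + (μ.colLen c.2 - 1 - c.1) + 1

variable {M : Type*} [CommMonoid M]

/-- For the strictly decreasing sequence `lᵢ = μᵢ + n - i` attached to the rows of `μ`, the set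
`{1, …, lᵢ}` is the disjoint union of the set of all `lᵢ - lⱼ` with `j > i` and the set of hook
lengths in the `i`-th row. -/
theorem prod_Icc_eq_prod_hooks_row (μ : YoungDiagram) {n : ℕ} (hn : μ.colLen 0 ≤ n) (f : ℕ → M)
    {i : ℕ} (hi : i < n) :
    ∏ v ∈ Finset.Icc 1 (μ.rowLen i + (n - 1 - i)), f v =
      (∏ j ∈ Finset.Ioo i n, f ((μ.rowLen i + (n - 1 - i)) - (μ.rowLen j + (n - 1 - j)))) *
        ∏ j ∈ Finset.range (μ.rowLen i), f (hook μ (i, j)) := by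
  classical
  have hrow : ∀ j, i < j → μ.rowLen j ≤ μ.rowLen i := fun j h => μ.rowLen_anti _ _ h.le
  have hcol : ∀ c, μ.colLen c ≤ n := fun c => (μ.colLen_anti 0 c (Nat.zero_le c)).trans hn
  have hcell : ∀ r c, c < μ.rowLen r ↔ r < μ.colLen c := fun r c => by
    rw [← YoungDiagram.mem_iff_lt_rowLen, YoungDiagram.mem_iff_lt_colLen]
  have hinj₁ : Set.InjOn (fun j => (μ.rowLen i + (n - 1 - i)) - (μ.rowLen j + (n - 1 - j)))
      (Finset.Ioo i n) := by
    intro j hj j' hj' h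
    rw [Finset.mem_coe, Finset.mem_Ioo] at hj hj'
    have h1 := hrow j hj.1
    have h2 := hrow j' hj'.1
    simp only at h
    rcases lt_trichotomy j j' with hlt | heq | hlt
    · have := μ.rowLen_anti _ _ hlt.le
      omega
    · exact heq
    · have := μ.rowLen_anti _ _ hlt.le
      omega
  have hinj₂ : Set.InjOn (fun c => hook μ (i, c)) (Finset.range (μ.rowLen i)) := by
    intro c hc c' hc' h
    rw [Finset.mem_coe, Finset.mem_range] at hc hc'
    have h1 := (hcell i c).1 hc
    have h2 := (hcell i c').1 hc'
    simp only [hook] at h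
    rcases lt_trichotomy c c' with hlt | heq | hlt
    · have := μ.colLen_anti _ _ hlt.le
      omega
    · exact heq
    · have := μ.colLen_anti _ _ hlt.le
      omega
  have hdisj : Disjoint
      ((Finset.Ioo i n).image fun j => (μ.rowLen i + (n - 1 - i)) - (μ.rowLen j + (n - 1 - j)))
      ((Finset.range (μ.rowLen i)).image fun c => hook μ (i, c)) := by
    -- an equality `lᵢ - lⱼ = hook (i, c)` fails whether or not the cell `(j, c)` belongs to `μ`
    rw [Finset.disjoint_left]
    intro v hv hv'
    obtain ⟨j, hj, rfl⟩ := Finset.mem_image.1 hv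
    obtain ⟨c, hc, h⟩ := Finset.mem_image.1 hv'
    rw [Finset.mem_range] at hc
    rw [Finset.mem_Ioo] at hj
    have h0 := hrow j hj.1
    have h1 := (hcell i c).1 hc
    have h2 := hcell j c
    simp only [hook] at h
    omega
  rw [← Finset.prod_image hinj₁, ← Finset.prod_image hinj₂, ← Finset.prod_union]
  · refine Finset.prod_congr (Finset.eq_of_subset_of_card_le ?_ ?_).symm fun _ _ => rfl
    · intro v hv
      rw [Finset.mem_Icc]
      rcases Finset.mem_union.1 hv with hv | hv
      · obtain ⟨j, hj, rfl⟩ := Finset.mem_image.1 hv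
        rw [Finset.mem_Ioo] at hj
        have := hrow j hj.1
        omega
      · obtain ⟨c, hc, rfl⟩ := Finset.mem_image.1 hv
        rw [Finset.mem_range] at hc
        have h1 := (hcell i c).1 hc
        have h2 := hcol c
        simp only [hook]
        omega
    · rw [Nat.card_Icc, Finset.card_union_of_disjoint, Finset.card_image_of_injOn hinj₁,
        Finset.card_image_of_injOn hinj₂, Nat.card_Ioo, Finset.card_range]
      · omega
      · exact hdisj
  · exact hdisj

theorem prod_Icc_eq_prod_hooks (μ : YoungDiagram) {n : ℕ} (hn : μ.colLen 0 ≤ n) (f : ℕ → M) :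
    ∏ i ∈ Finset.range n, ∏ v ∈ Finset.Icc 1 (μ.rowLen i + (n - 1 - i)), f v =
      (∏ i ∈ Finset.range n, ∏ j ∈ Finset.Ioo i n,
        f ((μ.rowLen i + (n - 1 - i)) - (μ.rowLen j + (n - 1 - j)))) *
        ∏ c ∈ μ.cells, f (hook μ c) := by
  rw [prod_cells_eq_prod_rows μ hn, ← Finset.prod_mul_distrib]
  exact Finset.prod_congr rfl fun i hi =>
    prod_Icc_eq_prod_hooks_row μ hn f (Finset.mem_range.1 hi)

theorem hook_transpose (μ : YoungDiagram) (i j : ℕ) :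
    hook μ.transpose (i, j) = hook μ (j, i) := by
  simp only [hook, YoungDiagram.rowLen_transpose, YoungDiagram.colLen_transpose]
  omega

/-- The same identity for the columns. -/
theorem prod_Icc_eq_prod_hooks_cols (μ : YoungDiagram) {m : ℕ} (hm : μ.rowLen 0 ≤ m)
    (f : ℕ → M) :
    ∏ i ∈ Finset.range m, ∏ v ∈ Finset.Icc 1 (μ.colLen i + (m - 1 - i)), f v =
      (∏ i ∈ Finset.range m, ∏ j ∈ Finset.Ioo i m,
        f ((μ.colLen i + (m - 1 - i)) - (μ.colLen j + (m - 1 - j)))) *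
        ∏ c ∈ μ.cells, f (hook μ c) := by
  have hm' : μ.transpose.colLen 0 ≤ m := by rwa [YoungDiagram.colLen_transpose]
  have h := prod_Icc_eq_prod_hooks μ.transpose hm' f
  rw [prod_cells_eq_prod_rows _ hm'] at h
  simp only [YoungDiagram.rowLen_transpose, hook_transpose] at h
  rw [h, prod_cells_eq_prod_cols μ hm]

theorem sum_hook (μ : YoungDiagram) :
    ∑ c ∈ μ.cells, hook μ c = ∑ c ∈ μ.cells, c.2 + ∑ c ∈ μ.cells, c.1 + μ.card := by
  have h1 : ∑ c ∈ μ.cells, (μ.rowLen c.1 - 1 - c.2) = ∑ c ∈ μ.cells, c.2 := by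
    rw [sum_cells_eq_sum_rows μ le_rfl, sum_cells_eq_sum_rows μ le_rfl]
    exact Finset.sum_congr rfl fun i _ => Finset.sum_range_reflect (fun j => j) _
  have h2 : ∑ c ∈ μ.cells, (μ.colLen c.2 - 1 - c.1) = ∑ c ∈ μ.cells, c.1 := by
    rw [sum_cells_eq_sum_cols μ le_rfl, sum_cells_eq_sum_cols μ le_rfl]
    exact Finset.sum_congr rfl fun i _ => Finset.sum_range_reflect (fun j => j) _
  simp only [hook]
  rw [Finset.sum_add_distrib, Finset.sum_add_distrib, h1, h2, YoungDiagram.card,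
    Finset.card_eq_sum_ones]

/-- `κ_μ` is twice the sum of the contents of the cells. -/
theorem kappa_eq_sum_contents (μ : YoungDiagram) :
    kappa μ = 2 * (((∑ c ∈ μ.cells, c.2 : ℕ) : ℤ) - ((∑ c ∈ μ.cells, c.1 : ℕ) : ℤ)) := by
  rw [kappa, card_eq_sum_rowLen, sum_cells_eq_sum_rows μ le_rfl, sum_cells_eq_sum_rows μ le_rfl]
  push_cast
  rw [← Finset.sum_add_distrib, ← Finset.sum_sub_distrib, Finset.mul_sum]
  refine Finset.sum_congr rfl fun i _ => ?_
  have h := Finset.sum_range_id_mul_two (μ.rowLen i)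
  have h' : (∑ j ∈ Finset.range (μ.rowLen i), (j : ℤ)) * 2 =
      (μ.rowLen i : ℤ) * ((μ.rowLen i : ℤ) - 1) := by
    rcases Nat.eq_zero_or_pos (μ.rowLen i) with h0 | h0
    · simp [h0]
    · have := congrArg (fun n : ℕ => (n : ℤ)) h
      push_cast [Nat.cast_sub (Nat.succ_le_of_lt h0)] at this
      simpa using this
  simp only [Finset.sum_const, Finset.card_range, nsmul_eq_mul]
  linear_combination -h'

theorem sum_fst_eq (μ : YoungDiagram) {m : ℕ} (hm : μ.rowLen 0 ≤ m) :
    ∑ c ∈ μ.cells, c.1 =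
      ∑ k ∈ Finset.range m, μ.colLen k * (μ.colLen k - 1) / 2 := by
  rw [sum_cells_eq_sum_cols μ hm]
  exact Finset.sum_congr rfl fun k _ => Finset.sum_range_id _

theorem sum_snd_eq (μ : YoungDiagram) {m : ℕ} (hm : μ.rowLen 0 ≤ m) :
    ∑ c ∈ μ.cells, c.2 = ∑ k ∈ Finset.range m, μ.colLen k * k := by
  rw [sum_cells_eq_sum_cols μ hm]
  refine Finset.sum_congr rfl fun k _ => ?_
  simp

end Hooks

/-! ### The hook formula for `s_μ(1, q, q², …)` and for `𝓦_μ` -/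

section Principal

theorem triangle_add (n d : ℕ) :
    (n + d) * (n + d - 1) / 2 = n * (n - 1) / 2 + d * (d - 1) / 2 + n * d := by
  induction d with
  | zero => simp
  | succ d ih =>
    rw [← add_assoc, Nat.triangle_succ, Nat.triangle_succ, ih]
    ring

theorem triangle_add_triangle (d : ℕ) : d * (d - 1) / 2 + d * (d - 1) / 2 + d = d * d := by
  induction d with
  | zero => simp
  | succ d ih =>
    rw [Nat.triangle_succ]
    linear_combination ih

/-- A variant of the Vandermonde determinant, with factorial powers in place of powers. -/
theorem det_factorial_powers {R : Type*} [CommRing R] {m : ℕ} (v : Fin m → R) (z : ℕ → R) :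
    Matrix.det (Matrix.of fun i j : Fin m =>
      ∏ t ∈ Finset.range (m - 1 - (j : ℕ)), (v i - z t)) =
      ∏ i, ∏ j ∈ Finset.Ioi i, (v i - v j) := by
  nontriviality R
  let p : Fin m → Polynomial R := fun j =>
    ∏ t ∈ Finset.range j, (Polynomial.X - Polynomial.C (z t))
  have h1 := Matrix.det_eval_matrixOfPolynomials_eq_det_vandermonde (v ∘ Fin.rev) p
    (fun j => by
      rw [Polynomial.natDegree_prod_of_monic _ _ fun t _ => Polynomial.monic_X_sub_C _]
      simp) (fun j => Polynomial.monic_prod_of_monic _ _ fun t _ => Polynomial.monic_X_sub_C _)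
  have h2 : (Matrix.of fun i j : Fin m => ∏ t ∈ Finset.range (m - 1 - (j : ℕ)), (v i - z t)) =
      (Matrix.of fun i j => (p j).eval ((v ∘ Fin.rev) i)).submatrix Fin.revPerm Fin.revPerm := by
    ext i j
    have hj : m - 1 - (j : ℕ) = m - ((j : ℕ) + 1) := by omega
    simp [p, Polynomial.eval_prod, hj]
  rw [h2, Matrix.det_submatrix_equiv_self, ← h1, Matrix.det_vandermonde, Finset.prod_sigma',
    Finset.prod_sigma']
  refine Finset.prod_nbij' (fun x => ⟨Fin.rev x.2, Fin.rev x.1⟩)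
    (fun x => ⟨Fin.rev x.2, Fin.rev x.1⟩) ?_ ?_ ?_ ?_ ?_
  · rintro ⟨i, j⟩ h
    simpa using h
  · rintro ⟨i, j⟩ h
    simpa using h
  · rintro ⟨i, j⟩ _
    simp
  · rintro ⟨i, j⟩ _
    simp
  · rintro ⟨i, j⟩ _
    simp

variable {K : Type*} [Field K]

theorem elem_principalSeries_sub {q : K} (hq : q ≠ 0) (hroot : ∀ n : ℕ, 0 < n → q ^ n ≠ 1)
    (a k : ℕ) :
    elem (principalSeries q) ((a : ℤ) - k) =
      coeff a (principalSeries q) * (q ^ (k * (k - 1) / 2 + k) *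
        ∏ t ∈ Finset.range k, (q⁻¹ ^ a - q⁻¹ ^ t)) := by
  induction k with
  | zero => simp [elem_natCast]
  | succ k ih =>
    have step : elem (principalSeries q) ((a : ℤ) - ((k + 1 : ℕ) : ℤ)) =
        elem (principalSeries q) ((a : ℤ) - k) * (q ^ (k + 1) * (q⁻¹ ^ a - q⁻¹ ^ k)) := by
      by_cases h : k < a
      · obtain ⟨d, rfl⟩ : ∃ d, a = k + (d + 1) := ⟨a - k - 1, by omega⟩
        have h1 : 1 - q ^ (d + 1) ≠ 0 := sub_ne_zero.2 (Ne.symm (hroot _ (Nat.succ_pos d)))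
        rw [show ((k + (d + 1) : ℕ) : ℤ) - ((k + 1 : ℕ) : ℤ) = (d : ℕ) by push_cast; ring,
          show ((k + (d + 1) : ℕ) : ℤ) - k = (d + 1 : ℕ) by push_cast; ring, elem_natCast,
          elem_natCast, coeff_principalSeries_succ]
        simp only [pow_add, pow_one] at h1
        simp only [inv_pow, pow_add, pow_one]
        field_simp
      · rw [elem_of_neg _ (by omega)]
        rcases eq_or_lt_of_le (not_lt.1 h) with rfl | h
        · simp
        · rw [elem_of_neg _ (by omega), zero_mul]
    rw [step, ih, Finset.prod_range_succ, Nat.triangle_succ]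
    ring

/-- The hook formula for the principal specialization of a Schur function. -/
theorem principalSkewSchur_mul_prod_hooks {q : K} (hq : q ≠ 0)
    (hroot : ∀ n : ℕ, 0 < n → q ^ n ≠ 1) (μ : YoungDiagram) :
    principalSkewSchur q μ ⊥ * ∏ c ∈ μ.cells, (1 - q ^ hook μ c) =
      q ^ ∑ c ∈ μ.cells, c.1 := by
  set m := μ.rowLen 0 with hm
  have hbot : (⊥ : YoungDiagram).rowLen 0 ≤ m := by rw [rowLen_bot]; exact Nat.zero_le _
  set a : ℕ → ℕ := fun i => μ.colLen i + (m - 1 - i) with ha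
  have hdet : principalSkewSchur q μ ⊥ =
      (∏ i ∈ Finset.range m, coeff (a i) (principalSeries q)) *
        ((∏ i ∈ Finset.range m, q ^ ((m - 1 - i) * (m - 1 - i - 1) / 2 + (m - 1 - i))) *
          ∏ i ∈ Finset.range m, ∏ j ∈ Finset.Ioo i m, (q⁻¹ ^ a i - q⁻¹ ^ a j)) := by
    have hM : (Matrix.of fun i j : Fin m =>
        elem (principalSeries q) ((beta m μ i : ℤ) - beta m ⊥ j)) =
        Matrix.of fun i j : Fin m => coeff (a i) (principalSeries q) *
          (Matrix.of fun i j : Fin m => q ^ ((m - 1 - (j : ℕ)) * (m - 1 - j - 1) / 2 +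
            (m - 1 - j)) * (Matrix.of fun i j : Fin m =>
              ∏ t ∈ Finset.range (m - 1 - (j : ℕ)), (q⁻¹ ^ a i - q⁻¹ ^ t)) i j) i j := by
      ext i j
      simp only [Matrix.of_apply]
      rw [elem_principalSeries_sub hq hroot]
      simp only [beta, colLen_bot, zero_add, ha]
    rw [principalSkewSchur, skewSchur_eq_det (constantCoeff_principalSeries q) le_rfl hbot, hM,
      Matrix.det_mul_column, Matrix.det_mul_row,
      det_factorial_powers (fun i : Fin m => q⁻¹ ^ a i) (fun t => q⁻¹ ^ t), Finset.prod_range,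
      Finset.prod_range, Finset.prod_range]
    congr 2
    refine Finset.prod_congr rfl fun i _ => ?_
    rw [← Fin.map_valEmbedding_Ioi, Finset.prod_map]
    rfl
  have hanti : ∀ i j, i < j → a j ≤ a i := fun i j hij => by
    have := μ.colLen_anti _ _ hij.le
    simp only [ha]
    omega
  have hdiff : ∀ i j, i < j → q⁻¹ ^ a i - q⁻¹ ^ a j = q⁻¹ ^ a i * (1 - q ^ (a i - a j)) := by
    intro i j hij
    have h1 : q ^ a i = q ^ (a i - a j) * q ^ a j := by
      rw [← pow_add, Nat.sub_add_cancel (hanti i j hij)]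
    rw [inv_pow, inv_pow]
    field_simp
    rw [h1]
    ring
  have hQ : ∏ i ∈ Finset.range m, ∏ v ∈ Finset.Icc 1 (a i), (1 - q ^ v) ≠ 0 :=
    Finset.prod_ne_zero_iff.2 fun i _ => Finset.prod_ne_zero_iff.2 fun v hv =>
      sub_ne_zero.2 (Ne.symm (hroot v (Finset.mem_Icc.1 hv).1))
  have hhook := prod_Icc_eq_prod_hooks_cols μ (le_refl m) fun v => 1 - q ^ v
  have hV : ∏ i ∈ Finset.range m, ∏ j ∈ Finset.Ioo i m, (q⁻¹ ^ a i - q⁻¹ ^ a j) =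
      (∏ i ∈ Finset.range m, q⁻¹ ^ (a i * (m - 1 - i))) *
        ∏ i ∈ Finset.range m, ∏ j ∈ Finset.Ioo i m, (1 - q ^ (a i - a j)) := by
    rw [← Finset.prod_mul_distrib]
    refine Finset.prod_congr rfl fun i _ => ?_
    rw [Finset.prod_congr rfl fun j hj => hdiff i j (Finset.mem_Ioo.1 hj).1,
      Finset.prod_mul_distrib, Finset.prod_const, Nat.card_Ioo, ← pow_mul]
    congr 3
    omega
  have he : ∏ i ∈ Finset.range m, coeff (a i) (principalSeries q) =
      (∏ i ∈ Finset.range m, q ^ (a i * (a i - 1) / 2)) /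
        ∏ i ∈ Finset.range m, ∏ v ∈ Finset.Icc 1 (a i), (1 - q ^ v) := by
    rw [← Finset.prod_div_distrib]
    exact Finset.prod_congr rfl fun i _ => by rw [principalSeries, coeff_mk]
  have hpow : (∏ i ∈ Finset.range m, q ^ (a i * (a i - 1) / 2)) *
      ((∏ i ∈ Finset.range m, q ^ ((m - 1 - i) * (m - 1 - i - 1) / 2 + (m - 1 - i))) *
        ∏ i ∈ Finset.range m, q⁻¹ ^ (a i * (m - 1 - i))) = q ^ ∑ c ∈ μ.cells, c.1 := by
    rw [sum_fst_eq μ (le_refl m), ← Finset.prod_pow_eq_pow_sum, ← Finset.prod_mul_distrib,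
      ← Finset.prod_mul_distrib]
    refine Finset.prod_congr rfl fun i _ => ?_
    simp only [ha]
    generalize m - 1 - i = d
    generalize μ.colLen i = n
    rw [inv_pow, ← mul_assoc, ← pow_add, ← div_eq_mul_inv, div_eq_iff (pow_ne_zero _ hq),
      ← pow_add, triangle_add]
    congr 1
    have := triangle_add_triangle d
    linear_combination this
  rw [hdet, hV, he, ← hpow]
  simp only [ha] at hQ hhook ⊢
  rw [hhook] at hQ ⊢
  have hA := left_ne_zero_of_mul hQ
  have hH := right_ne_zero_of_mul hQ
  field_simp

theorem principalSkewSchur_ne_zero {q : K} (hq : q ≠ 0) (hroot : ∀ n : ℕ, 0 < n → q ^ n ≠ 1)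
    (μ : YoungDiagram) : principalSkewSchur q μ ⊥ ≠ 0 := by
  intro h
  have := principalSkewSchur_mul_prod_hooks hq hroot μ
  rw [h, zero_mul] at this
  exact pow_ne_zero _ hq this.symm

theorem bracket_natCast {r : K} (hr : r ≠ 0) (n : ℕ) :
    bracket r n = -(r⁻¹ ^ n * (1 - (r ^ 2) ^ n)) := by
  rw [bracket, zpow_neg, zpow_natCast, inv_pow]
  field_simp
  ring

/-- The hook formula `𝓦_μ = q^{κ_μ/4} ∏ 1/[h]`. -/
theorem calW₁_mul_prod_hooks {r : K} (hr : r ≠ 0)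
    (hroot : ∀ n : ℕ, 0 < n → (r ^ 2) ^ n ≠ 1) (μ : YoungDiagram) :
    calW₁ r μ * ∏ c ∈ μ.cells, bracket r (hook μ c) = r ^ (kappa μ / 2) := by
  set l := μ.colLen 0 with hl
  have hb : ∀ n : ℕ, 0 < n → bracket r n ≠ 0 := fun n hn => by
    rw [bracket_natCast hr]
    exact neg_ne_zero.2 (mul_ne_zero (pow_ne_zero _ (inv_ne_zero hr))
      (sub_ne_zero.2 (Ne.symm (hroot n hn))))
  have hQ : ∏ i ∈ Finset.range l, ∏ v ∈ Finset.Icc 1 (μ.rowLen i + (l - 1 - i)),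
      bracket r (v : ℕ) ≠ 0 :=
    Finset.prod_ne_zero_iff.2 fun i _ => Finset.prod_ne_zero_iff.2 fun v hv =>
      hb v (Finset.mem_Icc.1 hv).1
  have hhook := prod_Icc_eq_prod_hooks μ (le_refl l) fun v : ℕ => bracket r v
  have hnum : ∏ j ∈ Finset.range l, ∏ i ∈ Finset.range j,
      bracket r ((μ.rowLen i : ℤ) - (μ.rowLen j : ℤ) + (j : ℤ) - (i : ℤ)) /
        bracket r ((j : ℤ) - (i : ℤ)) =
      (∏ i ∈ Finset.range l, ∏ j ∈ Finset.Ioo i l,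
        bracket r (((μ.rowLen i + (l - 1 - i)) - (μ.rowLen j + (l - 1 - j)) : ℕ) : ℤ)) /
        ∏ i ∈ Finset.range l, ∏ v ∈ Finset.Icc 1 (l - 1 - i), bracket r (v : ℕ) := by
    rw [Finset.prod_comm' (t' := Finset.range l) (s' := fun i => Finset.Ioo i l),
      ← Finset.prod_div_distrib]
    · refine Finset.prod_congr rfl fun i hi => ?_
      rw [Finset.prod_div_distrib]
      congr 1
      · refine Finset.prod_congr rfl fun j hj => ?_
        rw [Finset.mem_Ioo] at hj
        have := μ.rowLen_anti _ _ hj.1.le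
        congr 1
        omega
      · refine Finset.prod_nbij' (fun j => j - i) (fun v => v + i) ?_ ?_ ?_ ?_ ?_
        · intro j hj
          rw [Finset.mem_Ioo] at hj
          rw [Finset.mem_Icc]
          omega
        · intro v hv
          rw [Finset.mem_Icc] at hv
          rw [Finset.mem_Ioo]
          omega
        · intro j hj
          rw [Finset.mem_Ioo] at hj
          omega
        · intro v _
          omega
        · intro j hj
          rw [Finset.mem_Ioo] at hj
          congr 1
          omega
    · intro j i
      simp only [Finset.mem_range, Finset.mem_Ioo]
      omega
  have hsplit : (∏ i ∈ Finset.range l, ∏ v ∈ Finset.Icc 1 (l - 1 - i), bracket r (v : ℕ)) *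
      ∏ i ∈ Finset.range l, ∏ v ∈ Finset.Icc 1 (μ.rowLen i),
        bracket r ((v : ℤ) - ((i : ℤ) + 1) + (l : ℤ)) =
      ∏ i ∈ Finset.range l, ∏ v ∈ Finset.Icc 1 (μ.rowLen i + (l - 1 - i)),
        bracket r (v : ℕ) := by
    rw [← Finset.prod_mul_distrib]
    refine Finset.prod_congr rfl fun i hi => ?_
    rw [Finset.mem_range] at hi
    generalize μ.rowLen i = n
    induction n with
    | zero => simp
    | succ n ih =>
      rw [Finset.prod_Icc_succ_top (by omega), ← mul_assoc, ih, add_right_comm,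
        Finset.prod_Icc_succ_top (by omega)]
      congr 2
      omega
  have hfac : ∏ i ∈ Finset.range l, ∏ v ∈ Finset.Icc 1 (μ.rowLen i),
        1 / bracket r ((v : ℤ) - ((i : ℤ) + 1) + (l : ℤ)) =
      1 / ∏ i ∈ Finset.range l, ∏ v ∈ Finset.Icc 1 (μ.rowLen i),
        bracket r ((v : ℤ) - ((i : ℤ) + 1) + (l : ℤ)) := by
    simp only [one_div, Finset.prod_inv_distrib]
  rw [calW₁, ← hl, hnum, hfac]
  rw [← hsplit] at hQ
  have hB := left_ne_zero_of_mul hQ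
  have hC := right_ne_zero_of_mul hQ
  field_simp
  rw [hsplit, hhook]

theorem calW₁_eq {r : K} (hr : r ≠ 0) (hroot : ∀ n : ℕ, 0 < n → (r ^ 2) ^ n ≠ 1)
    (μ : YoungDiagram) :
    calW₁ r μ = (-1) ^ μ.card * r ^ (kappa μ + (μ.card : ℤ)) *
      principalSkewSchur (r ^ 2) μ ⊥ := by
  have hH : ∏ c ∈ μ.cells, (1 - (r ^ 2) ^ hook μ c) ≠ 0 :=
    Finset.prod_ne_zero_iff.2 fun c _ =>
      sub_ne_zero.2 (Ne.symm (hroot _ (Nat.succ_pos _)))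
  have h1 := calW₁_mul_prod_hooks hr hroot μ
  have h2 := principalSkewSchur_mul_prod_hooks (pow_ne_zero 2 hr) hroot μ
  have hprod : ∏ c ∈ μ.cells, bracket r (hook μ c) = (-1) ^ μ.card *
      (r⁻¹ ^ (∑ c ∈ μ.cells, hook μ c) * ∏ c ∈ μ.cells, (1 - (r ^ 2) ^ hook μ c)) := by
    simp only [bracket_natCast hr]
    rw [Finset.prod_neg, Finset.prod_mul_distrib, Finset.prod_pow_eq_pow_sum]
  have hsign : ((-1 : K) ^ μ.card) * (-1) ^ μ.card = 1 := by
    rw [← mul_pow]; simp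
  refine mul_right_cancel₀ hH ?_
  rw [mul_assoc, h2]
  rw [hprod, inv_pow] at h1
  have hr' := pow_ne_zero (∑ c ∈ μ.cells, hook μ c) hr
  have h3 : calW₁ r μ * ∏ c ∈ μ.cells, (1 - (r ^ 2) ^ hook μ c) =
      (-1) ^ μ.card * (r ^ (kappa μ / 2) * r ^ ∑ c ∈ μ.cells, hook μ c) := by
    rw [← h1]
    have hR := inv_mul_cancel₀ hr'
    linear_combination (-(calW₁ r μ * ∏ c ∈ μ.cells, (1 - (r ^ 2) ^ hook μ c))) * hsign -
      (-1) ^ μ.card * (-1) ^ μ.card * calW₁ r μ *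
        (∏ c ∈ μ.cells, (1 - (r ^ 2) ^ hook μ c)) * hR
  rw [h3, mul_assoc, ← pow_mul, ← zpow_natCast r (∑ c ∈ μ.cells, hook μ c),
    ← zpow_natCast r (2 * _), ← zpow_add₀ hr, ← zpow_add₀ hr, sum_hook,
    kappa_eq_sum_contents, Int.mul_ediv_cancel_left _ two_ne_zero]
  congr 2
  push_cast
  ring

end Principal

/-! ### The expansion of `s_ν(𝓔_μ)` -/

section Expansion

variable {K : Type*} [Field K]

theorem beta_le_of_le {m : ℕ} {ρ μ : YoungDiagram} (h : ρ ≤ μ) (k : Fin m) :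
    beta m ρ k ≤ beta m μ k :=
  Nat.add_le_add_right (le_iff_colLen.1 h k) _

theorem punctured_eq_mul_prod {q : K} (hq : q ≠ 0) (hroot : ∀ n : ℕ, 0 < n → q ^ n ≠ 1)
    (μ : YoungDiagram) {m : ℕ} (hm : μ.rowLen 0 ≤ m) (k : Fin m) :
    punctured q (beta m μ k) = rescale ((q ^ (m - 1))⁻¹) (calE q μ) *
      ∏ l ∈ Finset.univ.erase k, (1 + C (q⁻¹ ^ beta m μ l) * X) := by
  refine (eq_punctured ?_).symm
  rw [mul_assoc, Finset.prod_erase_mul _ _ (Finset.mem_univ k),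
    rescale_calE_mul_prod hq hroot μ hm (Nat.zero_lt_of_lt k.2)]

/-- The determinant of the kernel, expanded by the Cauchy–Binet formula. -/
theorem det_kernel {q : K} {μ ν : YoungDiagram} {m N : ℕ} (hμ : μ.rowLen 0 ≤ m)
    (hν : ν.rowLen 0 ≤ m) :
    Matrix.det (Matrix.of fun i k : Fin m => ∑ n ∈ Finset.range N,
      elem (principalSeries q) ((beta m ν i : ℤ) - n) *
        (q⁻¹ ^ n * elem (principalSeries q) ((beta m μ k : ℤ) - n))) =
      q⁻¹ ^ (∑ k : Fin m, (m - 1 - (k : ℕ))) * ∑ ρ ∈ (boxDiagrams_finite m N).toFinset,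
        q⁻¹ ^ ρ.card * principalSkewSchur q μ ρ * principalSkewSchur q ν ρ := by
  rw [det_sum_eq_sum_boxDiagrams N (fun i n => elem (principalSeries q) ((beta m ν i : ℤ) - n))
    fun n k => q⁻¹ ^ n * elem (principalSeries q) ((beta m μ k : ℤ) - n), Finset.mul_sum]
  refine Finset.sum_congr rfl fun ρ hρ => ?_
  have hρm := ((Set.Finite.mem_toFinset _).1 hρ).1
  have hE := constantCoeff_principalSeries q
  have hT : Matrix.det (Matrix.of fun j k : Fin m =>
      q⁻¹ ^ beta m ρ j * elem (principalSeries q) ((beta m μ k : ℤ) - beta m ρ j)) =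
      q⁻¹ ^ (ρ.card + ∑ k : Fin m, (m - 1 - (k : ℕ))) * principalSkewSchur q μ ρ := by
    rw [principalSkewSchur, skewSchur_eq_det hE hμ hρm, ← sum_beta m ρ hρm,
      ← Finset.prod_pow_eq_pow_sum, ← Matrix.det_transpose (Matrix.of _), ← Matrix.det_mul_row]
    rfl
  rw [hT, principalSkewSchur, principalSkewSchur, skewSchur_eq_det hE hν hρm, pow_add]
  ring

theorem principalSkewSchur_eq_zero {q : K} {μ ρ : YoungDiagram} (h : ¬ ρ ≤ μ) :
    principalSkewSchur q μ ρ = 0 :=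
  skewSchur_eq_zero_of_not_le (constantCoeff_principalSeries q) h

theorem mem_boxDiagrams_of_le {m N : ℕ} {ρ μ : YoungDiagram} (h : ρ ≤ μ) (hμ : μ.rowLen 0 ≤ m)
    (hN : ∀ k, beta m μ k < N) : ρ ∈ (boxDiagrams_finite m N).toFinset :=
  (Set.Finite.mem_toFinset _).2
    ⟨(rowLen_mono h 0).trans hμ, fun k => (beta_le_of_le h k).trans_lt (hN k)⟩

theorem finite_principalSkewSchur_ne_zero (q : K) (μ : YoungDiagram) :
    {ρ : YoungDiagram | principalSkewSchur q μ ρ ≠ 0}.Finite := by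
  refine (boxDiagrams_finite (μ.rowLen 0) (μ.colLen 0 + μ.rowLen 0)).subset fun ρ hρ => ?_
  have hle : ρ ≤ μ := by
    by_contra h
    exact hρ (principalSkewSchur_eq_zero h)
  refine (Set.Finite.mem_toFinset _).1 (mem_boxDiagrams_of_le hle le_rfl fun k => ?_)
  have := k.2
  have := μ.colLen_anti 0 k (Nat.zero_le _)
  simp only [beta]
  omega

/-- The factor by which the symmetric kernel differs from the coefficients of `punctured`. -/
def kernelFactor (q : K) (b : ℕ) : K :=
  (-1) ^ b * q⁻¹ ^ (b * (b - 1) / 2)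

theorem kernelFactor_ne_zero {q : K} (hq : q ≠ 0) (b : ℕ) : kernelFactor q b ≠ 0 :=
  mul_ne_zero (pow_ne_zero _ (by simp)) (pow_ne_zero _ (inv_ne_zero hq))

/-- The main identity, up to the determinant `D`, which depends on `μ` only. -/
theorem exists_det_mul_schur_calE {q : K} (hq : q ≠ 0) (hroot : ∀ n : ℕ, 0 < n → q ^ n ≠ 1)
    (μ : YoungDiagram) {m N : ℕ} (hμ : μ.rowLen 0 ≤ m) (hN : ∀ k, beta m μ k < N) :
    ∃ D : K, ∀ ν : YoungDiagram, ν.rowLen 0 ≤ m →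
      D * ((q ^ (m - 1))⁻¹ ^ ν.card * schur (calE q μ) ν) =
        (∏ i, kernelFactor q (beta m ν i)) * ∑ ρ ∈ (boxDiagrams_finite m N).toFinset,
          q⁻¹ ^ ρ.card * principalSkewSchur q μ ρ * principalSkewSchur q ν ρ := by
  set G := rescale ((q ^ (m - 1))⁻¹) (calE q μ) with hG
  have hG1 : constantCoeff G = 1 := by
    rw [hG, ← coeff_zero_eq_constantCoeff_apply, coeff_rescale, pow_zero, one_mul,
      coeff_zero_eq_constantCoeff_apply, constantCoeff_calE]
  have hq' := inv_ne_zero hq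
  have hδ := pow_ne_zero (∑ k : Fin m, (m - 1 - (k : ℕ))) hq'
  refine ⟨(q⁻¹ ^ (∑ k : Fin m, (m - 1 - (k : ℕ))))⁻¹ *
    ((∏ k, coeff (beta m μ k) (principalSeries q)) *
      Matrix.det (Matrix.of fun j k : Fin m => coeff (m - 1 - (j : ℕ))
        (∏ l ∈ Finset.univ.erase k, (1 + C (q⁻¹ ^ beta m μ l) * X)))), fun ν hν => ?_⟩
  have h1 := det_coeff_eq_skewSchur_mul hG1 (fun k => q⁻¹ ^ beta m μ k) hν
  rw [hG, schur_rescale (inv_ne_zero (pow_ne_zero _ hq)) (constantCoeff_calE q μ)] at h1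
  -- multiply the columns by `e_{a_k}` and insert the kernel
  have h2 : (∏ k, coeff (beta m μ k) (principalSeries q)) * Matrix.det (Matrix.of
      fun i k : Fin m => coeff (beta m ν i) (rescale ((q ^ (m - 1))⁻¹) (calE q μ) *
        ∏ l ∈ Finset.univ.erase k, (1 + C (q⁻¹ ^ beta m μ l) * X))) =
      (∏ i, kernelFactor q (beta m ν i)) * Matrix.det (Matrix.of fun i k : Fin m =>
        ∑ n ∈ Finset.range N, elem (principalSeries q) ((beta m ν i : ℤ) - n) *
          (q⁻¹ ^ n * elem (principalSeries q) ((beta m μ k : ℤ) - n))) := by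
    rw [← Matrix.det_mul_row, ← Matrix.det_mul_column]
    congr 1
    ext i k
    simp only [Matrix.of_apply]
    rw [← punctured_eq_mul_prod hq hroot μ hμ, coeff_punctured hq hroot _ _ N (hN k),
      kernelFactor]
  rw [h1, det_kernel hμ hν] at h2
  rw [mul_assoc, inv_mul_eq_iff_eq_mul₀ hδ]
  linear_combination h2

theorem schur_bot {R : Type*} [CommRing R] {E : R⟦X⟧} (hE : constantCoeff E = 1) :
    schur E ⊥ = 1 := by
  rw [schur, skewSchur_eq_det hE (m := 0) (by rw [rowLen_bot]) (by rw [rowLen_bot]),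
    Matrix.det_fin_zero]

theorem kernelFactor_add {q : K} (n d : ℕ) :
    kernelFactor q (n + d) =
      kernelFactor q d * ((-1) ^ n * q⁻¹ ^ (n * (n - 1) / 2) * q⁻¹ ^ (n * d)) := by
  rw [kernelFactor, kernelFactor, triangle_add, pow_add, pow_add, pow_add]
  ring

theorem prod_kernelFactor {q : K} (hq : q ≠ 0) {m : ℕ} {ν : YoungDiagram} (hν : ν.rowLen 0 ≤ m) :
    (q ^ (m - 1)) ^ ν.card * ∏ i, kernelFactor q (beta m ν i) =
      (∏ i, kernelFactor q (beta m ⊥ i)) *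
        ((-1) ^ ν.card * (q ^ (∑ c ∈ ν.cells, c.2) * q⁻¹ ^ (∑ c ∈ ν.cells, c.1))) := by
  rw [card_eq_sum_colLen ν hν, sum_snd_eq ν hν, sum_fst_eq ν hν]
  simp only [← Finset.prod_pow_eq_pow_sum, Finset.prod_range, ← Finset.prod_mul_distrib]
  refine Finset.prod_congr rfl fun k _ => ?_
  simp only [beta, colLen_bot, zero_add]
  rw [kernelFactor_add]
  obtain ⟨d, hd⟩ : ∃ d, m - 1 - (k : ℕ) = d := ⟨_, rfl⟩
  have hk : m - 1 = d + k := by have := k.2; omega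
  rw [hd, hk]
  simp only [inv_pow, ← pow_mul]
  rw [show (d + (k : ℕ)) * ν.colLen k = ν.colLen k * d + ν.colLen k * k by ring, pow_add]
  field_simp

theorem schur_calE {r q : K} (hr : r ≠ 0) (hqr : q = r ^ 2)
    (hroot : ∀ n : ℕ, 0 < n → q ^ n ≠ 1) (μ ν : YoungDiagram) :
    principalSkewSchur q μ ⊥ * schur (calE q μ) ν =
      (-1) ^ ν.card * r ^ kappa ν * ∑ᶠ ρ : YoungDiagram, q ^ (-(ρ.card : ℤ)) *
        principalSkewSchur q μ ρ * principalSkewSchur q ν ρ := by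
  have hq : q ≠ 0 := by rw [hqr]; exact pow_ne_zero 2 hr
  obtain ⟨m, hμ, hν⟩ : ∃ m, μ.rowLen 0 ≤ m ∧ ν.rowLen 0 ≤ m :=
    ⟨_, le_max_left _ _, le_max_right _ _⟩
  obtain ⟨N, hN⟩ : ∃ N, ∀ k, beta m μ k < N := by
    refine ⟨∑ k, (beta m μ k + 1), fun k => ?_⟩
    exact Finset.single_le_sum (f := fun k => beta m μ k + 1) (fun _ _ => Nat.zero_le _)
      (Finset.mem_univ k)
  obtain ⟨D, hD⟩ := exists_det_mul_schur_calE hq hroot μ hμ hN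
  have hsum : ∑ᶠ ρ : YoungDiagram, q ^ (-(ρ.card : ℤ)) *
        principalSkewSchur q μ ρ * principalSkewSchur q ν ρ =
      ∑ ρ ∈ (boxDiagrams_finite m N).toFinset,
        q⁻¹ ^ ρ.card * principalSkewSchur q μ ρ * principalSkewSchur q ν ρ := by
    rw [finsum_eq_sum_of_support_subset]
    · refine Finset.sum_congr rfl fun ρ _ => ?_
      rw [zpow_neg, zpow_natCast, inv_pow]
    · intro ρ hρ
      refine mem_boxDiagrams_of_le (μ := μ) ?_ hμ hN
      by_contra h
      exact hρ (by simp only [principalSkewSchur_eq_zero h, mul_zero, zero_mul])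
  -- the case of the empty shape determines `D`
  have hDμ : D = (∏ i, kernelFactor q (beta m ⊥ i)) * principalSkewSchur q μ ⊥ := by
    have h := hD ⊥ (by rw [rowLen_bot]; exact Nat.zero_le m)
    rw [schur_bot (constantCoeff_calE q μ), Finset.sum_eq_single ⊥] at h
    · have h1 : principalSkewSchur q ⊥ ⊥ = 1 := schur_bot (constantCoeff_principalSeries q)
      have h0 : (⊥ : YoungDiagram).card = 0 := rfl
      rw [h1, h0, pow_zero, pow_zero] at h
      simpa using h
    · intro ρ _ hne
      rw [principalSkewSchur_eq_zero (μ := ⊥) fun h => hne (le_bot_iff.1 h), mul_zero]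
    · intro h
      exact absurd (mem_boxDiagrams_of_le bot_le hμ hN) h
  have h := hD ν hν
  have hc := prod_kernelFactor hq hν
  have hF : ∏ i, kernelFactor q (beta m ⊥ i) ≠ 0 :=
    Finset.prod_ne_zero_iff.2 fun i _ => kernelFactor_ne_zero hq _
  have hQ : (q ^ (m - 1)) ^ ν.card ≠ 0 := pow_ne_zero _ (pow_ne_zero _ hq)
  have hκ : r ^ kappa ν = q ^ (∑ c ∈ ν.cells, c.2) * q⁻¹ ^ (∑ c ∈ ν.cells, c.1) := by
    rw [kappa_eq_sum_contents, hqr, inv_pow, zpow_mul, zpow_sub₀ (zpow_ne_zero 2 hr),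
      zpow_natCast, zpow_natCast, div_eq_mul_inv]
    norm_cast
  rw [hDμ, inv_pow] at h
  rw [hsum, hκ]
  refine mul_left_cancel₀ hF ?_
  rw [← mul_assoc _ ((-1) ^ ν.card * _), ← hc, mul_assoc ((q ^ (m - 1)) ^ ν.card), ← h]
  field_simp

theorem calW_eq {r q : K} (hr : r ≠ 0) (hqr : q = r ^ 2)
    (hroot : ∀ n : ℕ, 0 < n → q ^ n ≠ 1) (μ ν : YoungDiagram) :
    calW r μ ν = (-1) ^ (μ.card + ν.card) *
      r ^ (kappa μ + kappa ν + (μ.card : ℤ) + (ν.card : ℤ)) *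
        ∑ᶠ ρ : YoungDiagram, q ^ (-(ρ.card : ℤ)) *
          principalSkewSchur q μ ρ * principalSkewSchur q ν ρ := by
  have h := schur_calE hr hqr hroot μ ν
  subst hqr
  have hexp : r ^ (kappa μ + kappa ν + (μ.card : ℤ) + (ν.card : ℤ)) =
      r ^ (kappa μ + (μ.card : ℤ)) * r ^ kappa ν * r ^ ν.card := by
    rw [← zpow_natCast r ν.card, ← zpow_add₀ hr, ← zpow_add₀ hr]
    congr 1
    ring
  rw [calW, calW₁_eq hr hroot, pow_add, hexp]
  linear_combination (r ^ ν.card * (-1) ^ μ.card * r ^ (kappa μ + (μ.card : ℤ))) * h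

end Expansion

end ZhouW

end

theorem mainTheorem1 :
    -- the identities of rational functions of `r = q^{1/2}`
    (∀ (K : Type u) [Field K] (r q : K), r ≠ 0 → q = r ^ 2 → (∀ n : ℕ, 0 < n → q ^ n ≠ 1) →
      ∀ μ ν : YoungDiagram,
        {ρ : YoungDiagram | ZhouW.principalSkewSchur q μ ρ ≠ 0}.Finite ∧
        ZhouW.principalSkewSchur q μ ⊥ ≠ 0 ∧
        ZhouW.schur (ZhouW.calE q μ) ν =
          (-1) ^ ν.card * r ^ ZhouW.kappa ν *
            ∑ᶠ ρ : YoungDiagram, q ^ (-(ρ.card : ℤ)) *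
              (ZhouW.principalSkewSchur q μ ρ / ZhouW.principalSkewSchur q μ ⊥) *
                ZhouW.principalSkewSchur q ν ρ ∧
        ZhouW.calW r μ ν =
          (-1) ^ (μ.card + ν.card) *
            r ^ (ZhouW.kappa μ + ZhouW.kappa ν + (μ.card : ℤ) + (ν.card : ℤ)) *
              ∑ᶠ ρ : YoungDiagram, q ^ (-(ρ.card : ℤ)) *
                ZhouW.principalSkewSchur q μ ρ * ZhouW.principalSkewSchur q ν ρ ∧
        ZhouW.calW r μ ν = ZhouW.calW r ν μ) ∧
    -- the rational functions `s_{α/β}(1, q, q², …)` are the values of the skew Schur functions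
    (∀ q : ℂ, ‖q‖ < 1 → ∀ α β : YoungDiagram, β ≤ α →
      ZhouW.HasSkewSchurValue (fun k : ℕ => q ^ k) α β (ZhouW.principalSkewSchur q α β)) ∧
    -- `s_ν(𝓔_μ(q,t)) = s_ν(q^{μ₁-1}, q^{μ₂-2}, …)`
    (∀ q : ℂ, 1 < ‖q‖ → ∀ μ ν : YoungDiagram,
      ZhouW.HasSkewSchurValue (fun k : ℕ => q ^ ((μ.rowLen k : ℤ) - ((k : ℤ) + 1))) ν ⊥
        (ZhouW.schur (ZhouW.calE q μ) ν)) := by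
  refine ⟨fun K _ r q hr hqr hroot μ ν => ?_, fun q hq α β hβ =>
    ZhouW.hasSkewSchurValue_principal hq hβ, fun q hq μ ν => ZhouW.hasSkewSchurValue_calE hq μ ν⟩
  have hq : q ≠ 0 := by rw [hqr]; exact pow_ne_zero 2 hr
  have hμ := ZhouW.principalSkewSchur_ne_zero hq hroot μ
  refine ⟨ZhouW.finite_principalSkewSchur_ne_zero q μ, hμ, ?_,
    ZhouW.calW_eq hr hqr hroot μ ν, ?_⟩
  · refine mul_left_cancel₀ hμ ?_
    rw [ZhouW.schur_calE hr hqr hroot μ ν, mul_left_comm,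
      mul_finsum _ (ZhouW.principalSkewSchur q μ ⊥)]
    congr 1
    refine finsum_congr fun ρ => ?_
    field_simp
  · rw [ZhouW.calW_eq hr hqr hroot μ ν, ZhouW.calW_eq hr hqr hroot ν μ, add_comm μ.card ν.card,
      show ZhouW.kappa μ + ZhouW.kappa ν + (μ.card : ℤ) + (ν.card : ℤ) =
        ZhouW.kappa ν + ZhouW.kappa μ + (ν.card : ℤ) + (μ.card : ℤ) by ring]
    congr 1
    refine finsum_congr fun ρ => ?_
    ring
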